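/- Let $m \ge 3$ and let $\chi$ be a primitive (complex) Dirichlet character modulo $2^m$. For an integer $k \ge 0$ put $$\mathcal{L}_{k,\chi} = (1-\chi(5))\,L(-k,\chi),$$ where $L(s,\chi)$ is the analytic continuation of the Dirichlet $L$-function $\sum_{j\ge 1}\chi(j)j^{-s}$. Call a complex number $x$ $2$-integral if $Nx$ is an algebraic integer for some odd integer $N \ge 1$, and write $x \equiv y \pmod{2^r}$ if $x-y = 2^r z$ for some $2$-integral $z$. Let $n \ge 1$, and let $k \ge 0$ be an integer of parity opposite to $\chi$, that is, $\chi(-1) \ne (-1)^k$. Then $\mathcal{L}_{k,\chi}$ is $2$-integral, and for every odd integer $q \ge 1$, $$\mathcal{L}_{k+2^n q,\chi} - \mathcal{L}_{k,\chi} \equiv \frac{2^{n+2}}{1-\overline{\chi}(5)}\,\mathcal{L}_{d,\chi} \pmod{2^{n+3}},$$ where $d \in \{0,1\}$ and $d \equiv k \pmod 2$. Moreover, for every integer $l \ge 0$, $$\mathcal{L}_{k,\chi} \equiv \mathcal{L}_{l,\chi} \pmod{2^{n+2}} \quad\text{if and only if}\quad k \equiv l \pmod{2^n}.$$ -/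

import Mathlib

/-- A complex number `x` is 2-integral if `N * x` is an algebraic integer for some odd natural
number `N`, that is, if `x` is integral over the localization of `ℤ` at the prime `2`. -/
def IsTwoIntegral (x : ℂ) : Prop :=
  ∃ N : ℕ, Odd N ∧ IsIntegral ℤ ((N : ℂ) * x)

/-- The congruence `x ≡ y (mod 2 ^ r)` for 2-integral numbers: the difference `x - y` is `2 ^ r`
times a 2-integral number. -/
def CongrModTwoPow (r : ℕ) (x y : ℂ) : Prop :=
  ∃ z : ℂ, IsTwoIntegral z ∧ x - y = 2 ^ r * z

/-- The normalized value `(1 - χ(5)) L(-k, χ)`, where `L(s, χ)` is the analytically continued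
Dirichlet L-function of a character `χ` modulo `2 ^ m`. -/
noncomputable def calL {m : ℕ} (χ : DirichletCharacter ℂ (2 ^ m)) (k : ℕ) : ℂ :=
  (1 - χ 5) * χ.LFunction (-(k : ℂ))

/-! Write w = χ(5), π = 1 - w, and A for the ring `twoIntegers`. Primitivity makes w a nontrivial
root of unity of 2-power order, so π divides 2 in A but is not a unit, while every element congruent
to 1 modulo π is a unit. Odd integers, -1 and the values χ(a) at odd a are all congruent to 1 modulo
π, so modulo π only parities matter.

Take the Bernoulli formula for L(-k, χ) at level f = 2^R and compare it with itself under a ↦ 5a mod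
f. As R grows this gives, to any 2-adic precision, (1 - 5^(k+1) w) L(-k, χ) = w 5^k Σ χ(a) a^k
(⌊5a/f⌋ - 2). Under the parity condition, pairing a with f - a turns the sum into -2 T_k, with T_k
the `halfSum`; modulo π, T_k is a count that turns out to be odd. Since 1 - 5^(k+1) w = π u_k with
u_k ≡ 1 mod π, the normalized value is approximately -2 w 5^k T_k / u_k, and it is exactly 2x with x
≡ 1 mod π.

If k' = k + 2^n q with n ≥ 1 and q odd, T_k changes only by a multiple of 2^(n+2), whereas 5^k / u_k
changes by (5^k' - 5^k) / (π u_k u_k'), which is 2^(n+2)/π times an element congruent to 1 mod π. So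
the normalized values differ by 2^(n+3) (1/π + z) with z in A. The asserted right-hand side has the
same form, because the value at d is 2 times an element congruent to 1 mod π. The equivalence
follows since 2/π lies in A and 1/π does not; for l of the other parity the value is a trivial zero,
while half the value at k is a unit. -/

/-! ### The ring of 2-integral numbers -/

open Polynomial in
/-- For an algebraic integer `x` and odd `N`, the number `N + 2 * x` divides an odd integer in the
ring of algebraic integers. -/
lemma exists_mul_eq_odd_of_isIntegral {x : ℂ} (hx : IsIntegral ℤ x) {N : ℤ} (hN : Odd N) :
    ∃ y : ℂ, ∃ c : ℤ, IsIntegral ℤ y ∧ Odd c ∧ (N + 2 * x) * y = c := by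
  obtain ⟨p, hp, hpx⟩ := hx
  -- `Q` is monic, kills t = N + 2x, and reduces to (X - N)^deg modulo 2, so Q(0) is odd. Then t
  -- divides Q(t) - Q(0) = -Q(0), with quotient given by `divX`.
  set Q : ℤ[X] := (p.scaleRoots 2).comp (X - C N) with hQ
  have hroot : aeval ((N : ℂ) + 2 * x) Q = 0 := by
    have h1 : aeval ((algebraMap ℤ ℂ 2) * x) (p.scaleRoots 2) = 0 := scaleRoots_aeval_eq_zero hpx
    rw [hQ, aeval_comp]
    convert h1 using 2
    simp
  have hodd : Odd (Q.coeff 0) := by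
    rw [← Int.not_even_iff_odd, even_iff_two_dvd]
    intro h
    have h2 : ((Q.coeff 0 : ℤ) : ZMod 2) = 0 := (ZMod.intCast_zmod_eq_zero_iff_dvd _ 2).2 h
    have hN2 : (N : ZMod 2) ≠ 0 := by
      intro h0
      have := (ZMod.intCast_zmod_eq_zero_iff_dvd _ 2).1 h0
      rw [← Int.not_even_iff_odd, even_iff_two_dvd] at hN
      exact hN this
    have h3 : ((Q.coeff 0 : ℤ) : ZMod 2) = (Q.map (Int.castRingHom (ZMod 2))).eval 0 := by
      rw [← coeff_zero_eq_eval_zero, coeff_map]; rfl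
    have h4 : (p.scaleRoots 2).map (Int.castRingHom (ZMod 2)) = X ^ p.natDegree := by
      ext i
      rw [coeff_map, coeff_scaleRoots, coeff_X_pow]
      split_ifs with hi
      · subst hi; simp [hp.leadingCoeff]
      · rcases lt_or_gt_of_ne hi with h' | h'
        · have : p.natDegree - i ≠ 0 := by omega
          simp only [map_mul, map_pow]
          have h2 : (Int.castRingHom (ZMod 2)) 2 = 0 := by decide
          rw [h2, zero_pow this, mul_zero]
        · rw [coeff_eq_zero_of_natDegree_lt h']; simp
    rw [h3, hQ, map_comp, h4] at h2
    simp only [Polynomial.map_sub, map_X, Polynomial.map_C, eval_comp, eval_sub, eval_X, eval_C,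
      eval_pow] at h2
    have := eq_zero_of_pow_eq_zero h2
    simp only [eq_intCast, zero_sub, neg_eq_zero] at this
    exact hN2 this
  refine ⟨aeval ((N : ℂ) + 2 * x) Q.divX, -Q.coeff 0, ?_, hodd.neg, ?_⟩
  · have hx : IsIntegral ℤ x := ⟨p, hp, hpx⟩
    have h1 : IsIntegral ℤ ((N : ℂ) + 2 * x) :=
      (isIntegral_algebraMap (R := ℤ) (x := N)).add
        ((isIntegral_algebraMap (R := ℤ) (x := 2)).mul hx)
    exact adjoin_le_integralClosure h1 (aeval_mem_adjoin_singleton ℤ _)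
  · have := congrArg (aeval ((N : ℂ) + 2 * x)) (X_mul_divX_add Q)
    rw [hroot, map_add, map_mul, aeval_X, aeval_C] at this
    push_cast
    simp only [algebraMap_int_eq, eq_intCast] at this
    linear_combination this

/-- The ring of 2-integral complex numbers. -/
def twoIntegers : Subring ℂ where
  carrier := {x | IsTwoIntegral x}
  one_mem' := ⟨1, odd_one, by simpa using isIntegral_one⟩
  zero_mem' := ⟨1, odd_one, by simpa using isIntegral_zero⟩
  mul_mem' := by
    rintro a b ⟨N, hN, ha⟩ ⟨M, hM, hb⟩
    have e : ((N * M : ℕ) : ℂ) * (a * b) = (N * a) * (M * b) := by push_cast; ring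
    exact ⟨N * M, hN.mul hM, e ▸ ha.mul hb⟩
  add_mem' := by
    rintro a b ⟨N, hN, ha⟩ ⟨M, hM, hb⟩
    have e : ((N * M : ℕ) : ℂ) * (a + b) =
        algebraMap ℤ ℂ M * (N * a) + algebraMap ℤ ℂ N * (M * b) := by
      simp only [algebraMap_int_eq, eq_intCast]
      push_cast; ring
    exact ⟨N * M, hN.mul hM, e ▸ (isIntegral_algebraMap.mul ha).add (isIntegral_algebraMap.mul hb)⟩
  neg_mem' := by
    rintro a ⟨N, hN, ha⟩
    exact ⟨N, hN, by simpa using ha.neg⟩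

lemma IsIntegral.mem_twoIntegers {x : ℂ} (hx : IsIntegral ℤ x) : x ∈ twoIntegers :=
  ⟨1, odd_one, by simpa using hx⟩

lemma inv_intCast_mem_twoIntegers {c : ℤ} (hc : Odd c) : (c : ℂ)⁻¹ ∈ twoIntegers := by
  have h : (c.natAbs : ℂ)⁻¹ ∈ twoIntegers := by
    refine ⟨c.natAbs, Int.natAbs_odd.2 hc, ?_⟩
    rw [mul_inv_cancel₀]
    · exact isIntegral_one
    · have := Int.natAbs_odd.2 hc
      exact_mod_cast this.pos.ne'
  rcases Int.natAbs_eq c with h' | h' <;> rw [h']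
  · rwa [Int.cast_natCast]
  · rw [Int.cast_neg, Int.cast_natCast, inv_neg]
    exact neg_mem h

lemma inv_two_notMem_twoIntegers : (2 : ℂ)⁻¹ ∉ twoIntegers := by
  rintro ⟨N, hN, h⟩
  have h1 : ((N : ℂ) * 2⁻¹) = algebraMap ℚ ℂ ((N : ℚ) / 2) := by
    simp [div_eq_mul_inv]
  rw [h1, isIntegral_algebraMap_iff (algebraMap ℚ ℂ).injective,
    IsIntegrallyClosed.isIntegral_iff] at h
  obtain ⟨y, hy⟩ := h
  have h2 : ((2 * y : ℤ) : ℚ) = ((N : ℤ) : ℚ) := by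
    push_cast
    simp only [algebraMap_int_eq, eq_intCast] at hy
    rw [hy]; ring
  have h3 : 2 * y = (N : ℤ) := by exact_mod_cast h2
  obtain ⟨t, rfl⟩ := hN
  omega

lemma inv_one_add_two_mul_mem {z : ℂ} (hz : z ∈ twoIntegers) :
    1 + 2 * z ≠ 0 ∧ (1 + 2 * z)⁻¹ ∈ twoIntegers := by
  obtain ⟨N, hN, h⟩ := hz
  obtain ⟨y, c, hy, hc, hyc⟩ := exists_mul_eq_odd_of_isIntegral h (N := N) (by exact_mod_cast hN)
  have hN0 : (N : ℂ) ≠ 0 := by exact_mod_cast hN.pos.ne'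
  have hc0 : (c : ℂ) ≠ 0 := by
    have : c ≠ 0 := by rintro rfl; simp at hc
    exact_mod_cast this
  have key : (1 + 2 * z) * (N * y * (c : ℂ)⁻¹) = 1 := by
    field_simp
    rw [← hyc]; push_cast; ring
  refine ⟨left_ne_zero_of_mul_eq_one key, ?_⟩
  rw [inv_eq_of_mul_eq_one_right key]
  exact mul_mem (mul_mem (natCast_mem _ _) hy.mem_twoIntegers) (inv_intCast_mem_twoIntegers hc)

/-- The 2-integral numbers congruent to `1` modulo `1 - w`. -/
def oneModSubmonoid (w : ℂ) : Submonoid ℂ where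
  carrier := {x | x ∈ twoIntegers ∧ ∃ y ∈ twoIntegers, x = 1 + (1 - w) * y}
  one_mem' := ⟨one_mem _, 0, zero_mem _, by ring⟩
  mul_mem' := by
    rintro a b ⟨ha, y, hy, hay⟩ ⟨hb, z, hz, hbz⟩
    refine ⟨mul_mem ha hb, z + y * b, add_mem hz (mul_mem hy hb), ?_⟩
    linear_combination b * hay + hbz

/-! ### Arithmetic modulo 1 - w for a root of unity w of 2-power order -/

section RootOfUnity

variable {w : ℂ} {s : ℕ} (hw : w ^ 2 ^ s = 1) (hw1 : w ≠ 1)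

include hw

lemma mem_twoIntegers_of_pow_eq_one : w ∈ twoIntegers :=
  IsIntegral.mem_twoIntegers (IsIntegral.of_pow (n := 2 ^ s) (by positivity)
    (hw ▸ isIntegral_one))

lemma one_add_mul_mem_oneModSubmonoid {y : ℂ} (hy : y ∈ twoIntegers) :
    1 + (1 - w) * y ∈ oneModSubmonoid w :=
  ⟨add_mem (one_mem _) (mul_mem (sub_mem (one_mem _) (mem_twoIntegers_of_pow_eq_one hw)) hy),
    y, hy, rfl⟩

lemma self_mem_oneModSubmonoid : w ∈ oneModSubmonoid w := by
  simpa using one_add_mul_mem_oneModSubmonoid hw (neg_mem (one_mem twoIntegers))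

/-- Frobenius modulo 2: (1 - w)^(2^t) ≡ 1 - w^(2^t), and the right side vanishes at t = s. -/
lemma exists_one_sub_pow_eq_two_mul : ∃ z ∈ twoIntegers, (1 - w) ^ 2 ^ s = 2 * z := by
  have hwA := mem_twoIntegers_of_pow_eq_one hw
  have key : ∀ t : ℕ, ∃ z ∈ twoIntegers, (1 - w) ^ 2 ^ t = 1 - w ^ 2 ^ t + 2 * z := by
    intro t
    induction t with
    | zero => exact ⟨0, zero_mem _, by simp⟩
    | succ t ih =>
      obtain ⟨z, hz, h⟩ := ih
      refine ⟨w ^ 2 ^ t * w ^ 2 ^ t - w ^ 2 ^ t + 2 * z * (1 - w ^ 2 ^ t) + 2 * z ^ 2, ?_, ?_⟩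
      · have h2 : (2 : ℂ) ∈ twoIntegers := ofNat_mem _ 2
        have hp := pow_mem hwA (2 ^ t)
        exact add_mem (add_mem (sub_mem (mul_mem hp hp) hp)
          (mul_mem (mul_mem h2 hz) (sub_mem (one_mem _) hp))) (mul_mem h2 (pow_mem hz 2))
      · rw [pow_succ, pow_mul, pow_mul, h]; ring
  obtain ⟨z, hz, h⟩ := key s
  exact ⟨z, hz, by rw [h, hw]; ring⟩

include hw1

/-- Some power of w equals -1, and 1 - w divides 1 - w^j for every j. -/
lemma exists_one_sub_mul_eq_two : ∃ ρ ∈ twoIntegers, (1 - w) * ρ = 2 := by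
  have hwA := mem_twoIntegers_of_pow_eq_one hw
  classical
  have hex : ∃ t, w ^ 2 ^ t = 1 := ⟨s, hw⟩
  obtain ⟨t, ht, hmin⟩ : ∃ t, w ^ 2 ^ t = 1 ∧ ∀ t' < t, w ^ 2 ^ t' ≠ 1 :=
    ⟨Nat.find hex, Nat.find_spec hex, fun t' h => Nat.find_min hex h⟩
  rcases t with _ | t
  · simp at ht; exact absurd ht hw1
  · have h1 : w ^ 2 ^ t = -1 := by
      have h2 : (w ^ 2 ^ t) ^ 2 = 1 := by rw [← pow_mul, ← pow_succ]; exact ht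
      rcases mul_self_eq_one_iff.1 ((sq _).symm.trans h2) with h | h
      · exact absurd h (hmin t (by omega))
      · exact h
    refine ⟨∑ i ∈ Finset.range (2 ^ t), w ^ i, sum_mem fun i _ => pow_mem hwA i, ?_⟩
    rw [mul_neg_geom_sum, h1]; norm_num

/-- A power of 1 - w is a multiple of 2, so inverting 1 - w would invert 2. -/
lemma inv_one_sub_notMem_twoIntegers : (1 - w)⁻¹ ∉ twoIntegers := by
  intro h
  obtain ⟨z, hz, hzz⟩ := exists_one_sub_pow_eq_two_mul hw
  apply inv_two_notMem_twoIntegers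
  have h0 : 1 - w ≠ 0 := sub_ne_zero.2 hw1.symm
  have : (2 : ℂ)⁻¹ = z * ((1 - w)⁻¹) ^ 2 ^ s := by
    rw [inv_pow, hzz]
    have : (2 : ℂ) * z ≠ 0 := hzz ▸ pow_ne_zero _ h0
    have : z ≠ 0 := right_ne_zero_of_mul this
    field_simp
  rw [this]
  exact mul_mem hz (pow_mem h _)

lemma one_add_two_mul_mem_oneModSubmonoid {y : ℂ} (hy : y ∈ twoIntegers) :
    1 + 2 * y ∈ oneModSubmonoid w := by
  obtain ⟨ρ, hρ, h⟩ := exists_one_sub_mul_eq_two hw hw1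
  rw [← h, mul_assoc]
  exact one_add_mul_mem_oneModSubmonoid hw (mul_mem hρ hy)

lemma odd_mem_oneModSubmonoid {c : ℕ} (hc : Odd c) : (c : ℂ) ∈ oneModSubmonoid w := by
  obtain ⟨t, rfl⟩ := hc
  have := one_add_two_mul_mem_oneModSubmonoid hw hw1 (natCast_mem twoIntegers t)
  convert this using 1
  push_cast; ring

lemma neg_mem_oneModSubmonoid {x : ℂ} (hx : x ∈ oneModSubmonoid w) :
    -x ∈ oneModSubmonoid w := by
  have := one_add_two_mul_mem_oneModSubmonoid hw hw1 (neg_mem (one_mem twoIntegers))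
  convert mul_mem this hx using 1
  ring

omit hw1 in
-- For x = 1 + (1 - w)y, Frobenius gives x^(2^s) ≡ 1 + ((1 - w)y)^(2^s) ≡ 1 mod 2. Numbers congruent
-- to 1 mod 2 are already known to be units, hence so is x.
lemma inv_mem_oneModSubmonoid {x : ℂ} (hx : x ∈ oneModSubmonoid w) :
    x ≠ 0 ∧ x⁻¹ ∈ oneModSubmonoid w := by
  obtain ⟨hxA, y, hy, hxy⟩ := hx
  have hwA := mem_twoIntegers_of_pow_eq_one hw
  obtain ⟨r, hr⟩ := exists_add_pow_prime_pow_eq Nat.prime_two (1 : twoIntegers)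
    (⟨(1 - w) * y, mul_mem (sub_mem (one_mem _) hwA) hy⟩) s
  have hr' := congrArg (Subtype.val) hr
  push_cast at hr'
  obtain ⟨z, hz, hzz⟩ := exists_one_sub_pow_eq_two_mul hw
  obtain ⟨hne, hinv⟩ := inv_one_add_two_mul_mem
    (z := z * y ^ 2 ^ s + (1 - w) * y * r) (add_mem (mul_mem hz (pow_mem hy _))
      (mul_mem (mul_mem (sub_mem (one_mem _) hwA) hy) r.2))
  have hpow : x ^ 2 ^ s = 1 + 2 * (z * y ^ 2 ^ s + (1 - w) * y * r) := by
    have h2 : ((2 : twoIntegers) : ℂ) = 2 := rfl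
    rw [hxy, hr', mul_pow, hzz, h2]; ring
  rw [← hpow] at hne hinv
  have hx0 : x ≠ 0 := by
    rintro rfl
    exact hne (zero_pow (by positivity))
  have hxinv : x⁻¹ ∈ twoIntegers := by
    have : x⁻¹ = x ^ (2 ^ s - 1) * (x ^ 2 ^ s)⁻¹ := by
      have h1 : x ^ 2 ^ s = x ^ (2 ^ s - 1) * x := by
        rw [← pow_succ, Nat.sub_add_cancel Nat.one_le_two_pow]
      rw [h1]
      field_simp
    rw [this]
    exact mul_mem (pow_mem hxA _) hinv
  refine ⟨hx0, hxinv, -(y * x⁻¹), neg_mem (mul_mem hy hxinv), ?_⟩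
  field_simp
  linear_combination -hxy

end RootOfUnity

/-! ### Powers of 5 and of odd integers modulo powers of 2 -/

lemma exists_five_pow_two_pow_eq (t : ℕ) : ∃ c : ℕ, 5 ^ 2 ^ t = 1 + 2 ^ (t + 2) * (2 * c + 1) := by
  induction t with
  | zero => exact ⟨0, by norm_num⟩
  | succ t ih =>
    obtain ⟨c, hc⟩ := ih
    refine ⟨c + 2 ^ t * (2 * c + 1) ^ 2, ?_⟩
    rw [pow_succ, pow_mul, hc]
    ring

lemma exists_five_pow_two_pow_mul_eq (t : ℕ) {q : ℕ} (hq : Odd q) :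
    ∃ c : ℕ, 5 ^ (2 ^ t * q) = 1 + 2 ^ (t + 2) * (2 * c + 1) := by
  obtain ⟨c, hc⟩ := exists_five_pow_two_pow_eq t
  have key : ∀ q : ℕ, ∃ d : ℕ, 5 ^ (2 ^ t * q) = 1 + 2 ^ (t + 2) * (q + 2 * d) := by
    intro q
    induction q with
    | zero => exact ⟨0, by simp⟩
    | succ q ih =>
      obtain ⟨d, hd⟩ := ih
      refine ⟨d + c + 2 ^ (t + 1) * (q + 2 * d) * (2 * c + 1), ?_⟩
      rw [mul_add, pow_add, hd, mul_one, hc]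
      ring
  obtain ⟨d, hd⟩ := key q
  obtain ⟨r, rfl⟩ := hq
  exact ⟨r + d, by rw [hd]; ring⟩

lemma exists_odd_pow_two_pow_eq {a : ℕ} (ha : Odd a) (n : ℕ) :
    ∃ c : ℕ, a ^ 2 ^ (n + 1) = 1 + 2 ^ (n + 3) * c := by
  induction n with
  | zero =>
    obtain ⟨t, rfl⟩ := ha
    obtain ⟨r, hr⟩ := Nat.even_mul_succ_self t
    refine ⟨r, ?_⟩
    rw [zero_add, pow_one, zero_add]
    calc (2 * t + 1) ^ 2 = 1 + 4 * (t * (t + 1)) := by ring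
      _ = _ := by rw [show t * (t + 1) = r + r from hr]; ring
  | succ n ih =>
    obtain ⟨c, hc⟩ := ih
    refine ⟨c + 2 ^ (n + 2) * c ^ 2, ?_⟩
    rw [pow_succ 2 (n + 1), pow_mul, hc]
    ring

/-- Every integer congruent to `1` modulo `4` is a power of `5` modulo `2 ^ m`. -/
lemma exists_eq_five_pow_zmod (m : ℕ) {a : ℤ} (ha : (4 : ℤ) ∣ a - 1) :
    ∃ i : ℕ, (a : ZMod (2 ^ m)) = 5 ^ i := by
  have key : ∀ t : ℕ, ∃ i : ℕ, (2 : ℤ) ^ (t + 2) ∣ a - 5 ^ i := by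
    intro t
    induction t with
    | zero => exact ⟨0, by simpa using ha⟩
    | succ t ih =>
      obtain ⟨i, e, he⟩ := ih
      rcases Int.even_or_odd' e with ⟨r, rfl | rfl⟩
      · exact ⟨i, r, by rw [he]; ring⟩
      -- The error is an odd multiple of 2^(t+2); multiplying 5^i by 5^(2^t) changes it by another
      -- odd multiple, and the two cancel modulo 2^(t+3).
      · obtain ⟨c, hc⟩ := exists_five_pow_two_pow_eq t
        have hc' : (5 : ℤ) ^ 2 ^ t = 1 + 2 ^ (t + 2) * (2 * c + 1) := by exact_mod_cast hc
        have h5 : Odd ((5 : ℤ) ^ i) := Odd.pow (by decide)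
        obtain ⟨v, hv⟩ := h5
        refine ⟨i + 2 ^ t, r - v - c * 5 ^ i, ?_⟩
        rw [pow_add, hc']
        rw [hv] at he ⊢
        linear_combination he
  obtain ⟨i, hi⟩ := key m
  refine ⟨i, ?_⟩
  have h2 : ((2 ^ m : ℕ) : ℤ) ∣ a - 5 ^ i := by
    refine dvd_trans ?_ hi
    push_cast
    exact pow_dvd_pow 2 (by omega)
  have h := (ZMod.intCast_zmod_eq_zero_iff_dvd _ (2 ^ m)).2 h2
  push_cast at h
  exact sub_eq_zero.1 h

/-! ### Values of a primitive character modulo 2^m -/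

section Character

variable {m : ℕ} (χ : DirichletCharacter ℂ (2 ^ m))

lemma DirichletCharacter.apply_five_pow_two_pow : χ 5 ^ 2 ^ m = 1 := by
  obtain ⟨c, hc⟩ := exists_five_pow_two_pow_eq m
  have h : (5 : ZMod (2 ^ m)) ^ 2 ^ m = 1 := by
    have := congrArg (Nat.cast : ℕ → ZMod (2 ^ m)) hc
    have h2 : (2 : ZMod (2 ^ m)) ^ m = 0 := by
      have := ZMod.natCast_self (2 ^ m)
      push_cast at this
      exact this
    push_cast at this
    rw [this, pow_add, h2]
    ring
  rw [← map_pow, h, map_one]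

/-- The kernel of reduction modulo 4 consists of powers of 5, so χ(5) = 1 would make χ factor
through 4 < 2^m. -/
lemma DirichletCharacter.apply_five_ne_one (hm : 3 ≤ m) (hχ : χ.IsPrimitive) : χ 5 ≠ 1 := by
  intro h
  have h4 : 4 ∣ 2 ^ m := by
    have := pow_dvd_pow 2 (show 2 ≤ m by omega)
    simpa using this
  have hf : χ.FactorsThrough 4 := by
    rw [DirichletCharacter.factorsThrough_iff_ker_unitsMap h4]
    intro u hu
    rw [MonoidHom.mem_ker] at hu ⊢
    have hu' := congrArg Units.val hu
    rw [ZMod.unitsMap_val, Units.val_one] at hu'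
    have h41 : (4 : ℤ) ∣ ((u : ZMod (2 ^ m)).val : ℤ) - 1 := by
      apply (ZMod.intCast_zmod_eq_zero_iff_dvd _ 4).1
      rw [ZMod.cast_eq_val] at hu'
      push_cast
      rw [hu', sub_self]
    obtain ⟨i, hi⟩ := exists_eq_five_pow_zmod m h41
    rw [Int.cast_natCast, ZMod.natCast_zmod_val] at hi
    ext
    rw [MulChar.coe_toUnitHom, hi, map_pow, h, one_pow, Units.val_one]
  have hc : χ.conductor ≤ 4 := Nat.sInf_le hf
  rw [hχ] at hc
  have : 2 ^ 3 ≤ 2 ^ m := Nat.pow_le_pow_right (by norm_num) hm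
  omega

/-- Odd residues are ±5^i, and both χ(-1) = ±1 and χ(5) are congruent to 1 modulo 1 - χ(5). -/
lemma DirichletCharacter.apply_odd_mem_oneModSubmonoid (hm : 3 ≤ m) (hχ : χ.IsPrimitive)
    {a : ℕ} (ha : _root_.Odd a) : χ a ∈ oneModSubmonoid (χ 5) := by
  have hw := χ.apply_five_pow_two_pow
  have hw1 := χ.apply_five_ne_one hm hχ
  have hself := self_mem_oneModSubmonoid hw
  have hneg : χ (-1) ∈ oneModSubmonoid (χ 5) := by
    rcases χ.even_or_odd with h | h <;> rw [h]
    · exact one_mem _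
    · exact neg_mem_oneModSubmonoid hw hw1 (one_mem _)
  obtain ⟨t, rfl⟩ := ha
  rcases Nat.even_or_odd' t with ⟨r, rfl | rfl⟩
  · obtain ⟨i, hi⟩ := exists_eq_five_pow_zmod m (a := ((2 * (2 * r) + 1 : ℕ) : ℤ))
      ⟨r, by push_cast; ring⟩
    rw [Int.cast_natCast] at hi
    rw [hi, map_pow]
    exact pow_mem hself i
  · obtain ⟨i, hi⟩ := exists_eq_five_pow_zmod m (a := -((2 * (2 * r + 1) + 1 : ℕ) : ℤ))
      ⟨-r - 1, by push_cast; ring⟩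
    rw [Int.cast_neg, Int.cast_natCast] at hi
    rw [show ((2 * (2 * r + 1) + 1 : ℕ) : ZMod (2 ^ m)) = (-1) * 5 ^ i by rw [← hi]; ring,
      map_mul, map_pow]
    exact mul_mem hneg (pow_mem hself i)

lemma DirichletCharacter.apply_even_eq_zero (hm : 1 ≤ m) {a : ℕ} (ha : _root_.Even a) : χ a = 0 := by
  apply χ.map_nonunit
  rw [ZMod.isUnit_iff_coprime]
  intro h
  have h2 : a.Coprime 2 := h.coprime_dvd_right (dvd_pow_self 2 (by omega))
  rw [Nat.coprime_two_right] at h2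
  exact (Nat.not_even_iff_odd.2 h2) ha

lemma DirichletCharacter.apply_mem_twoIntegers (hm : 3 ≤ m) (hχ : χ.IsPrimitive) (a : ℕ) :
    χ a ∈ twoIntegers := by
  rcases Nat.even_or_odd a with h | h
  · rw [χ.apply_even_eq_zero (by omega) h]; exact zero_mem _
  · exact (χ.apply_odd_mem_oneModSubmonoid hm hχ h).1

end Character

/-! ### L-values as Bernoulli sums -/

open Filter Asymptotics Topology in
/-- The value at `0` of the L-function of a Dirichlet character which changes sign under
translation by `N`. -/
lemma DirichletCharacter.LFunction_zero_of_antiperiodic {M : ℕ} [NeZero M]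
    (χ : DirichletCharacter ℂ M) (hχ : χ ≠ 1) {N : ℕ} 
    (hN : ∀ a : ℕ, χ ((a + N : ℕ) : ZMod M) = -χ a) :
    χ.LFunction 0 = 2⁻¹ * ∑ a ∈ Finset.range N, χ a := by
  have hM : M ≠ 1 := fun h => hχ (DirichletCharacter.level_one' χ h)
  have hχ0' : χ 0 = 0 := χ.map_zero' hM
  have hχ0 : χ ((0 : ℕ) : ZMod M) = 0 := by rw [Nat.cast_zero, hχ0']
  set g : ℂ := 2⁻¹ * ∑ a ∈ Finset.range N, χ a with hg
  -- Antiperiodicity sums Σ χ(n) e^(-nt) to a finite sum over 1 + e^(-Nt), smooth at t = 0 with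
  -- value g. Subtracting g e^(-t) makes `G` vanish at 0, so its Mellin transform is holomorphic on
  -- Re s > -1, a region containing 0; the subtracted term accounts for the constant g in L(s, χ) -
  -- g = Γ(s)⁻¹ · mellin G s.
  set G : ℝ → ℂ := fun t => (∑ a ∈ Finset.range N, χ a * (Real.exp (-(a : ℝ) * t) : ℂ)) /
    (1 + (Real.exp (-(N : ℝ) * t) : ℂ)) - g * (Real.exp (-((1 : ℕ) : ℝ) * t) : ℂ) with hG
  have hden : ∀ t : ℝ, (1 + (Real.exp (-(N : ℝ) * t) : ℂ)) ≠ 0 := by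
    intro t
    have : (0 : ℝ) < 1 + Real.exp (-(N : ℝ) * t) := by positivity
    exact_mod_cast this.ne'
  have hexp : ∀ c : ℝ, Differentiable ℝ (fun t : ℝ => (Real.exp (c * t) : ℂ)) := by
    intro c t
    exact (((hasDerivAt_id t).const_mul c).exp.ofReal_comp).differentiableAt
  have hGdiff : Differentiable ℝ G := by
    refine Differentiable.sub (Differentiable.div ?_ ?_ hden) ?_
    · exact Differentiable.fun_sum fun a _ => (hexp _).const_mul _
    · exact (hexp _).const_add _
    · exact (hexp _).const_mul _
  have hG0 : G 0 = 0 := by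
    simp only [hG, mul_zero, Real.exp_zero, Complex.ofReal_one, mul_one, hg]
    ring
  have hbot : G =O[𝓝[>] 0] (fun t : ℝ => t ^ (-(-1 : ℝ))) := by
    have h := (hGdiff 0).isBigO_sub
    simp only [hG0, sub_zero] at h
    refine (h.mono nhdsWithin_le_nhds).congr (fun _ => rfl) (fun t => ?_)
    rw [neg_neg, Real.rpow_one]
  have htop : G =O[atTop] (fun t : ℝ => Real.exp (-(1 : ℝ) * t)) := by
    refine IsBigO.sub ?_ ?_
    · simp only [Finset.sum_div]
      refine IsBigO.fun_sum fun a _ => ?_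
      refine IsBigO.of_bound 1 ?_
      filter_upwards [eventually_ge_atTop 0] with t ht
      rcases Nat.eq_zero_or_pos a with rfl | ha
      · rw [hχ0]; simp; positivity
      · rw [norm_div, norm_mul, Complex.norm_real, Real.norm_of_nonneg (Real.exp_pos _).le, one_mul,
          Real.norm_of_nonneg (Real.exp_pos _).le]
        have h1 : ‖(1 + (Real.exp (-(N : ℝ) * t) : ℂ))‖ = 1 + Real.exp (-(N : ℝ) * t) := by
          rw [← Complex.ofReal_one, ← Complex.ofReal_add, Complex.norm_real,
            Real.norm_of_nonneg (by positivity)]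
        rw [h1]
        have h2 : Real.exp (-(a : ℝ) * t) ≤ Real.exp (-1 * t) := by
          apply Real.exp_le_exp.2
          have : (1 : ℝ) ≤ a := by exact_mod_cast ha
          nlinarith
        have h3 := χ.norm_le_one (a : ZMod M)
        rw [div_le_iff₀ (by positivity)]
        have h4 := Real.exp_pos (-(N : ℝ) * t)
        have h5 := Real.exp_pos (-1 * t)
        have h6 := Real.exp_pos (-(a : ℝ) * t)
        nlinarith [mul_pos h4 h5, norm_nonneg (χ (a : ZMod M))]
    · refine IsBigO.const_mul_left ?_ _
      refine IsBigO.of_bound 1 (Eventually.of_forall fun t => ?_)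
      rw [Complex.norm_real, one_mul, Nat.cast_one]
  have hloc : MeasureTheory.LocallyIntegrableOn G (Set.Ioi 0) :=
    hGdiff.continuous.continuousOn.locallyIntegrableOn measurableSet_Ioi
  have hmell : ∀ s : ℂ, -1 < s.re → DifferentiableAt ℂ (mellin G) s := fun s hs =>
    mellin_differentiableAt_of_isBigO_rpow_exp one_pos hloc htop hbot hs
  have hsum : ∀ t : ℝ, 0 < t → HasSum
      (fun n : ℕ => (χ n - if n = 1 then g else 0) * (Real.exp (-(n : ℝ) * t) : ℂ)) (G t) := by
    intro t ht
    have hs : Summable (fun n : ℕ => χ n * (Real.exp (-(n : ℝ) * t) : ℂ)) := by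
      have hgeo : Summable (fun n : ℕ => Real.exp (-t) ^ n) :=
        summable_geometric_of_lt_one (Real.exp_pos _).le (by simpa using ht)
      refine Summable.of_norm_bounded hgeo fun n => ?_
      rw [norm_mul, Complex.norm_real, Real.norm_of_nonneg (Real.exp_pos _).le, ← Real.exp_nat_mul]
      have h3 := χ.norm_le_one (n : ZMod M)
      rw [show (n : ℝ) * -t = -(n : ℝ) * t by ring]
      exact mul_le_of_le_one_left (Real.exp_pos _).le h3
    have h1 := hs.sum_add_tsum_nat_add N
    have h2 : ∑' n : ℕ, χ ((n + N : ℕ) : ZMod M) * (Real.exp (-((n + N : ℕ) : ℝ) * t) : ℂ) =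
        -(Real.exp (-(N : ℝ) * t) : ℂ) * ∑' n : ℕ, χ n * (Real.exp (-(n : ℝ) * t) : ℂ) := by
      rw [← tsum_mul_left]
      refine tsum_congr fun n => ?_
      rw [hN, Nat.cast_add (R := ℝ), neg_add, add_mul, Real.exp_add, Complex.ofReal_mul]
      ring
    rw [h2] at h1
    have h3 : HasSum (fun n : ℕ => χ n * (Real.exp (-(n : ℝ) * t) : ℂ))
        ((∑ a ∈ Finset.range N, χ a * (Real.exp (-(a : ℝ) * t) : ℂ)) /
          (1 + (Real.exp (-(N : ℝ) * t) : ℂ))) := by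
      convert hs.hasSum using 1
      rw [div_eq_iff (hden t)]
      linear_combination h1
    have h4 := hasSum_ite_eq 1 (g * (Real.exp (-((1 : ℕ) : ℝ) * t) : ℂ))
    refine (h3.sub h4).congr_fun ?_
    intro n
    by_cases hn : n = 1
    · subst hn; simp; ring
    · simp [hn]
  have heq : ∀ s : ℂ, 1 < s.re → χ.LFunction s - g = (Complex.Gamma s)⁻¹ * mellin G s := by
    intro s hs
    have hΓ : Complex.Gamma s ≠ 0 := Complex.Gamma_ne_zero_of_re_pos (by linarith)
    have hsummable : Summable fun n : ℕ =>
        ‖(χ n - if n = 1 then g else 0)‖ / (n : ℝ) ^ s.re := by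
      have h0 : Summable fun n : ℕ => (1 + ‖g‖) * (1 / (n : ℝ) ^ s.re) :=
        (Real.summable_one_div_nat_rpow.2 hs).mul_left _
      refine Summable.of_nonneg_of_le (fun n => by positivity) (fun n => ?_) h0
      rw [mul_one_div]
      gcongr
      refine (norm_sub_le _ _).trans (add_le_add (χ.norm_le_one _) ?_)
      split_ifs <;> simp
    have h1 := hasSum_mellin (a := fun n : ℕ => (χ n - if n = 1 then g else 0))
      (p := fun n : ℕ => (n : ℝ)) (F := G) (s := s) (fun n => by
        rcases Nat.eq_zero_or_pos n with rfl | hn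
        · left; simp only [hχ0]; simp
        · right; exact_mod_cast hn) (by linarith) (fun t ht => hsum t ht) hsummable
    have h2 : HasSum (fun n : ℕ => LSeries.term (fun n => χ n) s n - if n = 1 then g else 0)
        (χ.LFunction s - g) := by
      rw [χ.LFunction_eq_LSeries hs]
      refine HasSum.sub ?_ (hasSum_ite_eq 1 g)
      exact (ZMod.LSeriesSummable_of_one_lt_re χ hs).hasSum
    have h3 := h1.mul_left (Complex.Gamma s)⁻¹
    refine h2.unique (h3.congr_fun ?_)
    intro n
    rcases Nat.eq_zero_or_pos n with rfl | hn
    · simp [hχ0']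
    · rw [LSeries.term_of_ne_zero hn.ne']
      by_cases hn1 : n = 1
      · subst hn1; simp; field_simp
      · simp [hn1]; field_simp
  have hopen : IsOpen {s : ℂ | -1 < s.re} := isOpen_lt continuous_const Complex.continuous_re
  have hA1 : AnalyticOnNhd ℂ (fun s => χ.LFunction s - g) {s : ℂ | -1 < s.re} :=
    ((differentiable_LFunction hχ).sub_const g).differentiableOn.analyticOnNhd hopen
  have hA2 : AnalyticOnNhd ℂ (fun s => (Complex.Gamma s)⁻¹ * mellin G s) {s : ℂ | -1 < s.re} := by
    refine DifferentiableOn.analyticOnNhd (fun s hs => ?_) hopen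
    exact ((Complex.differentiable_one_div_Gamma s).mul (hmell s hs)).differentiableWithinAt
  have hpre : IsPreconnected {s : ℂ | -1 < s.re} := (convex_halfSpace_re_gt (-1)).isPreconnected
  have := hA1.eqOn_of_preconnected_of_eventuallyEq hA2 hpre (z₀ := 2) (by simp; norm_num) (by
    filter_upwards [(isOpen_lt continuous_const Complex.continuous_re).mem_nhds
      (show (1 : ℝ) < (2 : ℂ).re by simp)] with s hs
    exact heq s hs)
  have h0 := this (show (0 : ℂ) ∈ {s : ℂ | -1 < s.re} by simp)
  -- The convention Γ(0) = 0 with 0⁻¹ = 0 agrees with the true value of the entire function 1/Γ at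
  -- 0.
  simp only [Complex.Gamma_zero, inv_zero, zero_mul] at h0
  exact sub_eq_zero.1 h0

lemma ZMod.sum_eq_sum_range {f : ℕ} [NeZero f] {E : Type*} [AddCommMonoid E] (F : ZMod f → E) :
    ∑ j, F j = ∑ a ∈ Finset.range f, F a := by
  refine Finset.sum_nbij' ZMod.val (fun a => (a : ZMod f)) ?_ ?_ ?_ ?_ ?_
  · intro j _; exact Finset.mem_range.2 (ZMod.val_lt j)
  · intro a _; exact Finset.mem_univ _
  · intro j _; exact ZMod.natCast_zmod_val j
  · intro a ha; exact ZMod.val_cast_of_lt (Finset.mem_range.1 ha)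
  · intro j _; rw [ZMod.natCast_zmod_val]

/-- The value of the `k`-th Bernoulli polynomial at a complex number. -/
noncomputable def bernoulliEval (k : ℕ) (x : ℂ) : ℂ :=
  ((Polynomial.bernoulli k).map (algebraMap ℚ ℂ)).eval x

lemma DirichletCharacter.LFunction_neg_nat_of_ne_zero {f : ℕ} [NeZero f]
    (ψ : DirichletCharacter ℂ f) {k : ℕ} (hk : k ≠ 0) :
    ψ.LFunction (-(k : ℂ)) =
      -((f : ℂ) ^ k / (k + 1)) * ∑ a ∈ Finset.range f, ψ a * bernoulliEval (k + 1) (a / f) := by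
  have hf : (0 : ℝ) < f := by exact_mod_cast NeZero.pos f
  rw [DirichletCharacter.LFunction, ZMod.LFunction, neg_neg, Complex.cpow_natCast,
    ZMod.sum_eq_sum_range, Finset.mul_sum, Finset.mul_sum]
  refine Finset.sum_congr rfl fun a ha => ?_
  have hx : (a / f : ℝ) ∈ Set.Icc (0 : ℝ) 1 := by
    refine ⟨by positivity, ?_⟩
    rw [div_le_one hf]
    exact_mod_cast (Finset.mem_range.1 ha).le
  rw [ZMod.toAddCircle_natCast, HurwitzZeta.hurwitzZeta_neg_nat hk hx, bernoulliEval]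
  push_cast
  ring

section Character

variable {m : ℕ} (χ : DirichletCharacter ℂ (2 ^ m))

lemma DirichletCharacter.changeLevel_two_pow_apply (hm : 1 ≤ m) {R : ℕ} (hR : m ≤ R) (a : ℕ) :
    changeLevel (pow_dvd_pow 2 hR) χ a = χ a := by
  rcases Nat.even_or_odd a with h | h
  · rw [χ.apply_even_eq_zero hm h, DirichletCharacter.apply_even_eq_zero _ (hm.trans hR) h]
  · have hc : IsCoprime (a : ℤ) ((2 ^ R : ℕ) : ℤ) := by
      rw [Nat.isCoprime_iff_coprime]
      exact (Nat.coprime_two_right.2 h).pow_right R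
    have := χ.changeLevel_eq_cast_of_dvd' (pow_dvd_pow 2 hR) hc
    simpa using this

lemma DirichletCharacter.ne_one_of_isPrimitive (hm : 3 ≤ m) (hχ : χ.IsPrimitive) : χ ≠ 1 := by
  intro h
  apply χ.apply_five_ne_one hm hχ
  have : IsUnit (5 : ZMod (2 ^ m)) := by
    have := (ZMod.isUnit_iff_coprime 5 (2 ^ m)).2 (Nat.Coprime.pow_right m (by norm_num))
    simpa using this
  rw [h, MulChar.one_apply this]

/-- For odd a the shift is multiplication by 1 + 2^(m-1), which has square 1 and is the only
nontrivial element of the kernel of reduction modulo 2^(m-1); primitivity forces χ = -1 on it. -/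
lemma DirichletCharacter.apply_add_half (hm : 3 ≤ m) (hχ : χ.IsPrimitive) (a : ℕ) :
    χ ((a + 2 ^ (m - 1) : ℕ) : ZMod (2 ^ m)) = -χ a := by
  obtain ⟨r, rfl⟩ : ∃ r, m = r + 1 := ⟨m - 1, by omega⟩
  rw [Nat.add_sub_cancel]
  have hr : 2 ^ r = 2 * 2 ^ (r - 1) := by rw [← pow_succ']; congr 1; omega
  have h0 : (2 : ZMod (2 ^ (r + 1))) ^ (r + 1) = 0 := by
    have := ZMod.natCast_self (2 ^ (r + 1))
    push_cast at this
    exact this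
  rcases Nat.even_or_odd a with h | h
  · rw [χ.apply_even_eq_zero (by omega) h, χ.apply_even_eq_zero (by omega)
      (h.add (by rw [hr]; exact even_two_mul _)), neg_zero]
  · set u : ZMod (2 ^ (r + 1)) := 1 + 2 ^ r with hu
    have hau : ((a + 2 ^ r : ℕ) : ZMod (2 ^ (r + 1))) = u * a := by
      obtain ⟨t, rfl⟩ := h
      push_cast
      rw [hu]
      linear_combination (-(t : ZMod (2 ^ (r + 1)))) * h0
    have hu2 : u * u = 1 := by
      have h1 : (2 : ZMod (2 ^ (r + 1))) ^ r = 2 * 2 ^ (r - 1) := by exact_mod_cast congrArg _ hr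
      have h2 : (2 : ZMod (2 ^ (r + 1))) ^ r * 2 ^ r = 0 := by
        calc _ = (2 : ZMod (2 ^ (r + 1))) ^ (r + 1) * 2 ^ (r - 1) := by
              nth_rw 2 [h1]; ring
          _ = 0 := by rw [h0, zero_mul]
      rw [hu]
      linear_combination h0 + h2
    have hχu : χ u * χ u = 1 := by rw [← map_mul, hu2, map_one]
    have hne : χ u ≠ 1 := by
      intro h1
      have hd : 2 ^ r ∣ 2 ^ (r + 1) := pow_dvd_pow 2 (by omega)
      have hf : χ.FactorsThrough (2 ^ r) := by
        rw [DirichletCharacter.factorsThrough_iff_ker_unitsMap hd]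
        intro x hx
        rw [MonoidHom.mem_ker] at hx ⊢
        have hx' := congrArg Units.val hx
        rw [ZMod.unitsMap_val, Units.val_one, ZMod.cast_eq_val] at hx'
        have hdvd : ((2 ^ r : ℕ) : ℤ) ∣ ((x : ZMod (2 ^ (r + 1))).val : ℤ) - 1 := by
          apply (ZMod.intCast_zmod_eq_zero_iff_dvd _ (2 ^ r)).1
          push_cast
          rw [hx', sub_self]
        obtain ⟨e, he⟩ := hdvd
        have hxe : (x : ZMod (2 ^ (r + 1))) = 1 + 2 ^ r * (e : ZMod (2 ^ (r + 1))) := by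
          have := congrArg (Int.cast : ℤ → ZMod (2 ^ (r + 1))) he
          push_cast at this
          rw [ZMod.natCast_zmod_val] at this
          linear_combination this
        have hcases : (x : ZMod (2 ^ (r + 1))) = 1 ∨ (x : ZMod (2 ^ (r + 1))) = u := by
          rcases Int.even_or_odd' e with ⟨v, rfl | rfl⟩
          · left
            rw [hxe]; push_cast
            linear_combination (v : ZMod (2 ^ (r + 1))) * h0
          · right
            rw [hxe, hu]; push_cast
            linear_combination (v : ZMod (2 ^ (r + 1))) * h0
        ext
        rw [MulChar.coe_toUnitHom, Units.val_one]
        rcases hcases with h | h <;> rw [h]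
        · exact map_one _
        · exact h1
      have hc : χ.conductor ≤ 2 ^ r := Nat.sInf_le hf
      rw [hχ, pow_succ] at hc
      have : 0 < 2 ^ r := by positivity
      omega
    have hχu' : χ u = -1 := (mul_self_eq_one_iff.1 hχu).resolve_left hne
    rw [hau, map_mul, hχu', neg_one_mul]

lemma DirichletCharacter.sum_range_two_pow (hm : 3 ≤ m) (hχ : χ.IsPrimitive) {R : ℕ} (hR : m ≤ R) :
    ∑ a ∈ Finset.range (2 ^ R), χ a = 0 ∧
    ∑ a ∈ Finset.range (2 ^ R), χ a * a =
      -2 ^ (R - 1) * ∑ a ∈ Finset.range (2 ^ (m - 1)), χ a := by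
  induction R, hR using Nat.le_induction with
  | base =>
    have h2 : 2 ^ m = 2 ^ (m - 1) + 2 ^ (m - 1) := by rw [← mul_two, ← pow_succ]; congr 1; omega
    rw [congrArg Finset.range h2, Finset.sum_range_add, Finset.sum_range_add,
      ← Finset.sum_add_distrib, ← Finset.sum_add_distrib, Finset.mul_sum]
    constructor
    · refine Finset.sum_eq_zero fun a _ => ?_
      rw [add_comm (2 ^ (m - 1)) a, χ.apply_add_half hm hχ, add_neg_cancel]
    · refine Finset.sum_congr rfl fun a _ => ?_
      rw [add_comm (2 ^ (m - 1)) a, χ.apply_add_half hm hχ]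
      push_cast; ring
  | succ R hR ih =>
    obtain ⟨h0, h1⟩ := ih
    have hper : ∀ a : ℕ, χ ((2 ^ R + a : ℕ) : ZMod (2 ^ m)) = χ a := by
      intro a
      congr 1
      rw [Nat.cast_add, (ZMod.natCast_eq_zero_iff _ _).2 (pow_dvd_pow 2 hR), zero_add]
    rw [pow_succ, mul_two, Finset.sum_range_add, Finset.sum_range_add]
    simp only [hper]
    refine ⟨by rw [h0, add_zero], ?_⟩
    push_cast
    simp only [mul_add]
    rw [Finset.sum_add_distrib, ← Finset.sum_mul, h0, h1]
    obtain ⟨r, rfl⟩ : ∃ r, R = r + 1 := ⟨R - 1, by omega⟩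
    simp only [Nat.add_sub_cancel]
    ring

/-- Raising the level to 2^R changes nothing because χ(2) = 0 kills the Euler factor. The freedom in
R is what supplies arbitrary 2-adic precision. The case k = 0 rests on the antiperiodic formula. -/
lemma DirichletCharacter.LFunction_neg_nat (hm : 3 ≤ m) (hχ : χ.IsPrimitive) (k : ℕ) {R : ℕ}
    (hR : m ≤ R) :
    χ.LFunction (-(k : ℂ)) = -(((2 ^ R : ℕ) : ℂ) ^ k / (k + 1)) *
      ∑ a ∈ Finset.range (2 ^ R), χ a * bernoulliEval (k + 1) (a / (2 ^ R : ℕ)) := by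
  have hne := χ.ne_one_of_isPrimitive hm hχ
  rcases eq_or_ne k 0 with rfl | hk
  · obtain ⟨h0, h1⟩ := χ.sum_range_two_pow hm hχ hR
    rw [Nat.cast_zero, neg_zero,
      χ.LFunction_zero_of_antiperiodic hne (χ.apply_add_half hm hχ)]
    have hb : ∀ x : ℂ, bernoulliEval (0 + 1) x = x - 2⁻¹ := by
      intro x
      simp [bernoulliEval, Polynomial.bernoulli_one]
    simp only [hb, mul_sub, Finset.sum_sub_distrib, ← mul_div_assoc]
    rw [← Finset.sum_mul, h0, ← Finset.sum_div, h1]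
    obtain ⟨r, rfl⟩ : ∃ r, R = r + 1 := ⟨R - 1, by omega⟩
    simp only [Nat.add_sub_cancel]
    push_cast
    field_simp
    ring
  · have h := (changeLevel (pow_dvd_pow 2 hR) χ).LFunction_neg_nat_of_ne_zero hk
    rw [DirichletCharacter.LFunction_changeLevel _ _ (.inl hne)] at h
    have hp : ∏ p ∈ (2 ^ R).primeFactors,
        (1 - χ ((p : ℕ) : ZMod (2 ^ m)) * ((p : ℕ) : ℂ) ^ (-(-(k : ℂ)))) = 1 := by
      rw [Nat.primeFactors_prime_pow (by omega) Nat.prime_two, Finset.prod_singleton,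
        χ.apply_even_eq_zero (by omega) even_two, zero_mul, sub_zero]
    rw [hp, mul_one] at h
    rw [h]
    congr 1
    refine Finset.sum_congr rfl fun a _ => ?_
    rw [χ.changeLevel_two_pow_apply (by omega) hR]

end Character

/-! ### Bernoulli polynomials modulo the level -/

/-- Beyond its two leading terms, the scaled polynomial has only terms divisible by f, up to
denominators depending on k alone. Independence of `D` from f is essential, since f later tends
2-adically to 0. -/
lemma exists_mul_bernoulli_eval_sub_eq (k : ℕ) : ∃ D : ℕ, D ≠ 0 ∧ ∀ f : ℕ, f ≠ 0 → ∀ y : ℤ, ∃ z : ℤ,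
    (D : ℚ) * ((f : ℚ) ^ k / (k + 1) * (Polynomial.bernoulli (k + 1)).eval ((y : ℚ) / f) -
      ((y : ℚ) ^ (k + 1) / ((k + 1) * f) - (y : ℚ) ^ k / 2)) = f * z := by
  set r : ℕ → ℚ := fun i => bernoulli (i + 2) * (k + 1).choose (i + 2) / (k + 1) with hr
  refine ⟨∏ i ∈ Finset.range k, (r i).den, Finset.prod_ne_zero_iff.2 fun i _ => (r i).den_nz, ?_⟩
  intro f hf y
  have hf' : (f : ℚ) ≠ 0 := by exact_mod_cast hf
  have hk : (k + 1 : ℚ) ≠ 0 := by positivity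
  have h1 : (f : ℚ) ^ k / (k + 1) * (Polynomial.bernoulli (k + 1)).eval ((y : ℚ) / f) -
      ((y : ℚ) ^ (k + 1) / ((k + 1) * f) - (y : ℚ) ^ k / 2) =
      ∑ i ∈ Finset.range k, r i * (f ^ (i + 1) * y ^ (k - 1 - i)) := by
    rw [Polynomial.bernoulli, Polynomial.eval_finsetSum, Finset.sum_range_succ',
      Finset.sum_range_succ']
    simp only [Polynomial.eval_monomial]
    have h2 : ∀ i ∈ Finset.range k, (f : ℚ) ^ k / (k + 1) *
        (bernoulli (i + 1 + 1) * ((k + 1).choose (i + 1 + 1)) *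
          ((y : ℚ) / f) ^ (k + 1 - (i + 1 + 1))) = r i * (f ^ (i + 1) * y ^ (k - 1 - i)) := by
      intro i hi
      have hi' := Finset.mem_range.1 hi
      obtain ⟨e, rfl⟩ : ∃ e, k = i + 1 + e := ⟨k - (i + 1), by omega⟩
      rw [show i + 1 + e + 1 - (i + 1 + 1) = e by omega, show i + 1 + e - 1 - i = e by omega,
        div_pow, hr, pow_add]
      field_simp
    rw [mul_add, mul_add, Finset.mul_sum, Finset.sum_congr rfl h2]
    simp only [zero_add, bernoulli_zero, bernoulli_one, Nat.choose_one_right, Nat.choose_zero_right,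
      Nat.add_sub_cancel, Nat.sub_zero]
    push_cast
    rw [div_pow, div_pow]
    field_simp
    ring
  have h3 : ∀ i ∈ Finset.range k, ∃ c : ℤ, ((∏ i ∈ Finset.range k, (r i).den : ℕ) : ℚ) * r i = c := by
    intro i hi
    obtain ⟨e, he⟩ := Finset.dvd_prod_of_mem (fun i => (r i).den) hi
    refine ⟨e * (r i).num, ?_⟩
    rw [he]
    push_cast
    rw [mul_comm ((r i).den : ℚ) e, mul_assoc, Rat.den_mul_eq_num]
  choose! c hc using h3
  refine ⟨∑ i ∈ Finset.range k, c i * (f ^ i * y ^ (k - 1 - i)), ?_⟩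
  rw [h1]
  push_cast
  rw [Finset.mul_sum, Finset.mul_sum]
  refine Finset.sum_congr rfl fun i hi => ?_
  rw [← hc i hi]
  push_cast
  ring

/-- The terms in 1/f cancel; the linear term of (5a - jf)^(k+1) contributes -j(5a)^k, and the
half-terms contribute (5/2 - 1/2)(5a)^k = 2(5a)^k. -/
lemma exists_mul_bernoulli_eval_five_eq (k : ℕ) : ∃ D : ℕ, D ≠ 0 ∧
    ∀ f : ℕ, f ≠ 0 → ∀ a j : ℤ, ∃ z : ℤ,
    (D : ℚ) * ((f : ℚ) ^ k / (k + 1) * ((Polynomial.bernoulli (k + 1)).eval ((5 * a - j * f : ℚ) / f) -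
      5 ^ (k + 1) * (Polynomial.bernoulli (k + 1)).eval ((a : ℚ) / f)) + (j - 2) * (5 * a) ^ k) =
      f * z := by
  obtain ⟨D, hD, h⟩ := exists_mul_bernoulli_eval_sub_eq k
  -- The factor k + 1 clears the second-order remainder j² f e/(k + 1), and 2 clears the change f
  -- e'/2 of the half-term.
  refine ⟨2 * (k + 1) * D, by positivity, fun f hf a j => ?_⟩
  have hf' : (f : ℚ) ≠ 0 := by exact_mod_cast hf
  have hk : (k + 1 : ℚ) ≠ 0 := by positivity
  obtain ⟨z₁, h₁⟩ := h f hf (5 * a - j * f)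
  obtain ⟨z₂, h₂⟩ := h f hf a
  obtain ⟨e, he⟩ := Polynomial.powAddExpansion (5 * a) (-(j * f)) (k + 1)
  obtain ⟨e', he'⟩ : ∃ e' : ℤ, (5 * a - j * f) ^ k - (5 * a) ^ k = f * e' := by
    obtain ⟨t, ht⟩ := sub_dvd_pow_sub_pow (5 * a - j * f) (5 * a) k
    exact ⟨-j * t, by rw [ht]; ring⟩
  have heQ := congrArg (Int.cast : ℤ → ℚ) he
  have heQ' := congrArg (Int.cast : ℤ → ℚ) he'
  push_cast at heQ heQ' h₁ h₂
  rw [← sub_eq_add_neg] at heQ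
  refine ⟨2 * D * j ^ 2 * e - (k + 1) * D * e' + 2 * (k + 1) * (z₁ - 5 ^ (k + 1) * z₂), ?_⟩
  push_cast
  set B₁ := (Polynomial.bernoulli (k + 1)).eval ((5 * a - j * f : ℚ) / f)
  set B₂ := (Polynomial.bernoulli (k + 1)).eval ((a : ℚ) / f)
  have h3 : (5 * a - j * f : ℚ) ^ (k + 1) / ((k + 1) * f) =
      (5 * a) ^ (k + 1) / ((k + 1) * f) - j * (5 * a) ^ k + j ^ 2 * f * e / (k + 1) := by
    rw [heQ]; field_simp; ring
  have h4 : (5 * a - j * f : ℚ) ^ k = (5 * a) ^ k + f * e' := by linear_combination heQ'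
  rw [h3, h4] at h₁
  have h5 : (5 : ℚ) ^ (k + 1) * ((a : ℚ) ^ (k + 1) / ((k + 1) * f) - (a : ℚ) ^ k / 2) =
      (5 * a) ^ (k + 1) / ((k + 1) * f) - 5 * (5 * a) ^ k / 2 := by
    rw [mul_pow, mul_pow]; ring
  have h6 : j ^ 2 * f * (e : ℚ) / (k + 1) * (k + 1) = j ^ 2 * f * e := by field_simp
  linear_combination 2 * (k + 1 : ℚ) * h₁ - 2 * (k + 1) * 5 ^ (k + 1) * h₂ +
    2 * D * h6 - 2 * (k + 1) * D * h5

lemma exists_mul_bernoulliEval_five_eq (k : ℕ) : ∃ D : ℕ, D ≠ 0 ∧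
    ∀ f : ℕ, f ≠ 0 → ∀ a : ℕ, ∃ z : ℤ,
    (D : ℂ) * ((f : ℂ) ^ k / (k + 1) * (bernoulliEval (k + 1) (((5 * a) % f : ℕ) / f) -
      5 ^ (k + 1) * bernoulliEval (k + 1) (a / f)) + ((5 * a / f : ℕ) - 2) * (5 * a) ^ k) =
      f * z := by
  obtain ⟨D, hD, h⟩ := exists_mul_bernoulli_eval_five_eq k
  refine ⟨D, hD, fun f hf a => ?_⟩
  obtain ⟨z, hz⟩ := h f hf a (5 * a / f : ℕ)
  refine ⟨z, ?_⟩
  have hB : ∀ x : ℚ, bernoulliEval (k + 1) (x : ℂ) =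
      (((Polynomial.bernoulli (k + 1)).eval x : ℚ) : ℂ) := by
    intro x
    rw [bernoulliEval, Polynomial.eval_map_algebraMap]
    have := Polynomial.aeval_algebraMap_apply ℂ x (Polynomial.bernoulli (k + 1))
    simpa using this
  have hmod : (((5 * a) % f : ℕ) : ℂ) / f =
      (((5 * (a : ℤ) - (5 * a / f : ℕ) * f : ℚ) / f : ℚ) : ℂ) := by
    have := Nat.div_add_mod (5 * a) f
    have h2 : (((5 * a) % f : ℕ) : ℚ) = 5 * (a : ℤ) - (5 * a / f : ℕ) * f := by
      have h3 := congrArg (Nat.cast : ℕ → ℚ) this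
      rw [Nat.cast_add, Nat.cast_mul, Nat.cast_mul 5 a] at h3
      push_cast at h3 ⊢
      linear_combination h3
    rw [Int.cast_natCast] at h2
    rw [Int.cast_natCast, ← h2]
    push_cast; rfl
  have ha : (a : ℂ) / f = (((a : ℤ) / f : ℚ) : ℂ) := by push_cast; rfl
  rw [hmod, ha, hB, hB]
  have := congrArg (Rat.cast : ℚ → ℂ) hz
  push_cast at this ⊢
  exact this

/-! ### Multiplication by 5 and the half sum -/

lemma Finset.sum_range_mul_mod {E : Type*} [AddCommMonoid E] {f c : ℕ} (hf : c.Coprime f)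
    (hf0 : 0 < f) (F : ℕ → E) :
    ∑ a ∈ Finset.range f, F (c * a % f) = ∑ a ∈ Finset.range f, F a := by
  have hinj : Set.InjOn (fun a => c * a % f) (Finset.range f : Set ℕ) := by
    intro a ha b hb hab
    have h1 : c * a ≡ c * b [MOD f] := hab
    have h2 := Nat.ModEq.cancel_left_of_coprime hf.symm h1
    exact Nat.ModEq.eq_of_lt_of_lt h2 (by simpa using ha) (by simpa using hb)
  have himg : (Finset.range f).image (fun a => c * a % f) = Finset.range f := by
    apply Finset.eq_of_subset_of_card_le
    · intro x hx
      obtain ⟨a, -, rfl⟩ := Finset.mem_image.1 hx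
      exact Finset.mem_range.2 (Nat.mod_lt _ hf0)
    · rw [Finset.card_image_of_injOn hinj]
  conv_rhs => rw [← himg, Finset.sum_image hinj]

lemma Finset.sum_range_two_mul_of_even_eq_zero {E : Type*} [AddCommMonoid E] {F : ℕ → E}
    (hF : ∀ a, Even a → F a = 0) (n : ℕ) :
    ∑ a ∈ Finset.range (2 * n), F a = ∑ b ∈ Finset.range n, F (2 * b + 1) := by
  induction n with
  | zero => simp
  | succ n ih =>
    rw [mul_add, mul_one, Finset.sum_range_succ, Finset.sum_range_succ, Finset.sum_range_succ, ih,
      hF (2 * n) (even_two_mul n), add_zero]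

/-- For `b < g`, the number `2 - ⌊5 * (2 * b + 1) / (4 * g)⌋`. -/
def floorDefect (g b : ℕ) : ℕ :=
  (if 10 * b + 5 < 4 * g then 1 else 0) + (if 10 * b + 5 < 8 * g then 1 else 0)

lemma floorDefect_add {g b : ℕ} (hb : b < g) : 5 * (2 * b + 1) / (4 * g) + floorDefect g b = 2 := by
  unfold floorDefect
  split_ifs with h1 h2 h2
  · rw [Nat.div_eq_of_lt (by omega)]
  · omega
  · rw [Nat.div_eq_of_lt_le (k := 1) (by omega) (by omega)]
  · rw [Nat.div_eq_of_lt_le (k := 2) (by omega) (by omega)]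

/-- This count is the residue of `halfSum` modulo 1 - χ(5). The two conditions hold for ⌊(4g+4)/10⌋
and ⌊(8g+4)/10⌋ values of b, with odd total for each nonzero residue of g mod 5. -/
lemma odd_sum_floorDefect {g : ℕ} (hg : ¬ 5 ∣ g) :
    Odd (∑ b ∈ Finset.range g, floorDefect g b) := by
  have h1 : ((Finset.range g).filter fun b => 10 * b + 5 < 4 * g) =
      Finset.range ((4 * g + 4) / 10) := by
    ext b; simp only [Finset.mem_filter, Finset.mem_range]; omega
  have h2 : ((Finset.range g).filter fun b => 10 * b + 5 < 8 * g) =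
      Finset.range ((8 * g + 4) / 10) := by
    ext b; simp only [Finset.mem_filter, Finset.mem_range]; omega
  simp only [floorDefect]
  rw [Finset.sum_add_distrib, ← Finset.card_filter, ← Finset.card_filter, h1, h2,
    Finset.card_range, Finset.card_range, Nat.odd_iff]
  have hdiv := Nat.div_add_mod g 5
  have hmod : g % 5 = 1 ∨ g % 5 = 2 ∨ g % 5 = 3 ∨ g % 5 = 4 := by omega
  rcases hmod with h | h | h | h <;> rw [h] at hdiv <;> omega

section Character

variable {m : ℕ} (χ : DirichletCharacter ℂ (2 ^ m))

/-- Permuting residues by a ↦ 5a multiplies the Bernoulli sum by χ(5)⁻¹; subtracting 5^(k+1) times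
the original leaves the floor sum modulo 2^R. -/
lemma DirichletCharacter.exists_mul_LFunction_sub_sum_eq (hm : 3 ≤ m) (hχ : χ.IsPrimitive) (k : ℕ) :
    ∃ D : ℕ, D ≠ 0 ∧ ∀ R, m ≤ R → ∃ ξ ∈ twoIntegers,
      D * ((1 - 5 ^ (k + 1) * χ 5) * χ.LFunction (-(k : ℂ)) - χ 5 * 5 ^ k *
        ∑ a ∈ Finset.range (2 ^ R), χ a * (a ^ k * ((5 * a / 2 ^ R : ℕ) - 2))) = 2 ^ R * ξ := by
  obtain ⟨D, hD, h⟩ := exists_mul_bernoulliEval_five_eq k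
  refine ⟨D, hD, fun R hR => ?_⟩
  choose z hz using h (2 ^ R) (by positivity)
  have hwA := mem_twoIntegers_of_pow_eq_one χ.apply_five_pow_two_pow
  refine ⟨-χ 5 * ∑ a ∈ Finset.range (2 ^ R), χ a * z a, mul_mem (neg_mem hwA)
    (sum_mem fun a _ => mul_mem (χ.apply_mem_twoIntegers hm hχ a) (intCast_mem _ _)), ?_⟩
  have hL := χ.LFunction_neg_nat hm hχ k hR
  have hre := Finset.sum_range_mul_mod (f := 2 ^ R) (c := 5)
    (Nat.Coprime.pow_right R (by norm_num)) (by positivity)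
    (fun a => χ a * bernoulliEval (k + 1) (a / (2 ^ R : ℕ)))
  have hper : ∀ a : ℕ, χ ((5 * a % 2 ^ R : ℕ) : ZMod (2 ^ m)) = χ 5 * χ a := by
    intro a
    rw [← map_mul]
    congr 1
    have : ((5 * a % 2 ^ R : ℕ) : ZMod (2 ^ m)) = ((5 * a : ℕ) : ZMod (2 ^ m)) := by
      rw [ZMod.natCast_eq_natCast_iff]
      exact (Nat.mod_modEq _ _).of_dvd (pow_dvd_pow 2 hR)
    rw [this]; push_cast; rfl
  simp only [hper] at hre
  have key : ∑ a ∈ Finset.range (2 ^ R), χ a * ((2 ^ R : ℕ) * z a) =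
      D * (((2 ^ R : ℕ) : ℂ) ^ k / (k + 1) * (∑ a ∈ Finset.range (2 ^ R),
        χ a * bernoulliEval (k + 1) ((5 * a % 2 ^ R : ℕ) / (2 ^ R : ℕ)) -
        5 ^ (k + 1) * ∑ a ∈ Finset.range (2 ^ R), χ a * bernoulliEval (k + 1) (a / (2 ^ R : ℕ))) +
        5 ^ k * ∑ a ∈ Finset.range (2 ^ R), χ a * (a ^ k * ((5 * a / 2 ^ R : ℕ) - 2))) := by
    simp only [← hz, mul_sub, mul_add, Finset.mul_sum, ← Finset.sum_sub_distrib,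
      ← Finset.sum_add_distrib]
    refine Finset.sum_congr rfl fun a _ => ?_
    rw [mul_pow]
    ring
  have h2 : χ 5 * ∑ a ∈ Finset.range (2 ^ R),
      χ a * bernoulliEval (k + 1) ((5 * a % 2 ^ R : ℕ) / (2 ^ R : ℕ)) =
      ∑ a ∈ Finset.range (2 ^ R), χ a * bernoulliEval (k + 1) (a / (2 ^ R : ℕ)) := by
    rw [← hre, Finset.mul_sum]
    exact Finset.sum_congr rfl fun a _ => by ring
  have h3 : ∑ a ∈ Finset.range (2 ^ R), χ a * (((2 ^ R : ℕ) : ℂ) * z a) =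
      2 ^ R * ∑ a ∈ Finset.range (2 ^ R), χ a * z a := by
    rw [Finset.mul_sum]
    exact Finset.sum_congr rfl fun a _ => by push_cast; ring
  rw [h3] at key
  rw [hL]
  linear_combination χ 5 * key + (D : ℂ) * ((2 ^ R : ℕ) : ℂ) ^ k / (k + 1) * h2

/-- The main term of `L(-k, χ)` at level `4 * g`. -/
noncomputable def DirichletCharacter.halfSum (k g : ℕ) : ℂ :=
  ∑ b ∈ Finset.range g, χ ((2 * b + 1 : ℕ) : ZMod (2 ^ m)) * (((2 * b + 1 : ℕ) : ℂ) ^ k * floorDefect g b)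

/-- Under a ↦ 4g - a the factor ⌊5a/4g⌋ - 2 changes sign for odd a, and so does χ(a)a^k modulo 4g by
the parity condition. The two halves of the sum therefore agree. -/
lemma DirichletCharacter.exists_sum_eq_neg_two_mul_halfSum (hm : 3 ≤ m) (hχ : χ.IsPrimitive) {k : ℕ}
    (hk : χ (-1) * (-1) ^ k = -1) {g : ℕ} (hg : 2 ^ m ∣ 4 * g) :
    ∃ ξ ∈ twoIntegers, ∑ a ∈ Finset.range (4 * g), χ a * (a ^ k * ((5 * a / (4 * g) : ℕ) - 2)) =
      -2 * χ.halfSum k g + 4 * g * ξ := by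
  set h : ℕ → ℂ := fun a => χ a * ((a : ℂ) ^ k * ((5 * a / (4 * g) : ℕ) - 2)) with hh
  have heven : ∀ a, _root_.Even a → h a = 0 := fun a ha => by
    rw [hh]; simp only [χ.apply_even_eq_zero (by omega) ha, zero_mul]
  have hA := χ.apply_mem_twoIntegers hm hχ
  have hfirst : ∀ b ∈ Finset.range g, h (2 * b + 1) =
      -(χ ((2 * b + 1 : ℕ) : ZMod (2 ^ m)) * (((2 * b + 1 : ℕ) : ℂ) ^ k * floorDefect g b)) := by
    intro b hb
    have h1 := congrArg (Nat.cast : ℕ → ℂ) (floorDefect_add (Finset.mem_range.1 hb))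
    rw [Nat.cast_add, Nat.cast_ofNat] at h1
    rw [hh]
    linear_combination (χ ((2 * b + 1 : ℕ) : ZMod (2 ^ m)) * (((2 * b + 1 : ℕ) : ℂ) ^ k)) * h1
  have hsecond : ∀ b ∈ Finset.range g, ∃ ξ ∈ twoIntegers, h (2 * (g + (g - 1 - b)) + 1) =
      -(χ ((2 * b + 1 : ℕ) : ZMod (2 ^ m)) * (((2 * b + 1 : ℕ) : ℂ) ^ k * floorDefect g b)) +
        4 * g * ξ := by
    intro b hb
    have hbg := Finset.mem_range.1 hb
    have hdef := floorDefect_add hbg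
    set a := 2 * b + 1 with ha
    have h1 : 2 * (g + (g - 1 - b)) + 1 = 4 * g - a := by omega
    have hmod : ¬ 4 * g ∣ 5 * a := by
      intro hd
      have : 2 ∣ 5 * a := dvd_trans ⟨2 * g, by ring⟩ hd
      omega
    have hdiv : 5 * (4 * g - a) / (4 * g) = 4 - 5 * a / (4 * g) := by
      have h2 := Nat.div_add_mod (5 * a) (4 * g)
      have h3 : 0 < 5 * a % (4 * g) := Nat.pos_of_ne_zero fun h => hmod (Nat.dvd_of_mod_eq_zero h)
      have h4 := Nat.mod_lt (5 * a) (show 0 < 4 * g by omega)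
      have h5 : 5 * a / (4 * g) ≤ 2 := by omega
      set r := 5 * a % (4 * g)
      set j := 5 * a / (4 * g)
      interval_cases j
      · rw [Nat.div_eq_of_lt_le (k := 4) (by omega) (by omega)]
      · rw [Nat.div_eq_of_lt_le (k := 3) (by omega) (by omega)]
      · rw [Nat.div_eq_of_lt_le (k := 2) (by omega) (by omega)]
    have hcast : ((5 * (4 * g - a) / (4 * g) : ℕ) : ℂ) = 2 + floorDefect g b := by
      rw [hdiv, show 4 - 5 * a / (4 * g) = 2 + floorDefect g b by omega]
      push_cast; rfl
    have hχa : χ ((4 * g - a : ℕ) : ZMod (2 ^ m)) = χ (-1) * χ a := by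
      rw [← map_mul]
      congr 1
      rw [Nat.cast_sub (by omega), (ZMod.natCast_eq_zero_iff _ _).2 hg]
      ring
    obtain ⟨e, he⟩ : ∃ e : ℤ, (4 * g - a : ℤ) ^ k = (-1) ^ k * a ^ k + 4 * g * e := by
      obtain ⟨e, he⟩ := sub_dvd_pow_sub_pow (4 * g - a : ℤ) (-a) k
      refine ⟨e, ?_⟩
      rw [← mul_pow, neg_one_mul]
      linear_combination he
    have heC : ((4 * g - a : ℕ) : ℂ) ^ k = (-1) ^ k * (a : ℂ) ^ k + 4 * g * e := by
      have := congrArg (Int.cast : ℤ → ℂ) he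
      rw [Nat.cast_sub (by omega)]
      push_cast at this ⊢
      exact this
    have hneg : χ (-1) ∈ twoIntegers := by
      rcases χ.even_or_odd with h | h <;> rw [h]
      · exact one_mem _
      · exact neg_mem (one_mem _)
    refine ⟨χ (-1) * χ a * e * floorDefect g b, mul_mem (mul_mem (mul_mem hneg (hA a))
      (intCast_mem _ _)) (natCast_mem _ _), ?_⟩
    rw [h1, hh]
    simp only
    rw [hχa, heC, hcast]
    linear_combination (χ a * a ^ k * floorDefect g b) * hk
  choose! ξ hξ hsec using hsecond
  refine ⟨∑ b ∈ Finset.range g, ξ b, sum_mem hξ, ?_⟩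
  have h0 := Finset.sum_range_two_mul_of_even_eq_zero heven (g + g)
  rw [show 2 * (g + g) = 4 * g by ring] at h0
  rw [h0, Finset.sum_range_add, ← Finset.sum_range_reflect (fun x => h (2 * (g + x) + 1)),
    Finset.sum_congr rfl hfirst, Finset.sum_congr rfl hsec, Finset.sum_add_distrib,
    Finset.sum_neg_distrib, ← Finset.mul_sum]
  simp only [halfSum]
  ring

lemma DirichletCharacter.halfSum_mem_oneModSubmonoid (hm : 3 ≤ m) (hχ : χ.IsPrimitive) (k : ℕ)
    {g : ℕ} (hg : ¬ 5 ∣ g) : χ.halfSum k g ∈ oneModSubmonoid (χ 5) := by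
  have hw := χ.apply_five_pow_two_pow
  have hw1 := χ.apply_five_ne_one hm hχ
  have h : ∀ b : ℕ, ∃ y ∈ twoIntegers,
      χ ((2 * b + 1 : ℕ) : ZMod (2 ^ m)) * ((2 * b + 1 : ℕ) : ℂ) ^ k = 1 + (1 - χ 5) * y := by
    intro b
    have ho : _root_.Odd (2 * b + 1) := odd_two_mul_add_one b
    exact (mul_mem (χ.apply_odd_mem_oneModSubmonoid hm hχ ho)
      (pow_mem (odd_mem_oneModSubmonoid hw hw1 ho) k)).2
  choose y hy hyy using h
  obtain ⟨-, u, hu, huu⟩ := odd_mem_oneModSubmonoid hw hw1 (odd_sum_floorDefect hg)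
  have key : χ.halfSum k g =
      1 + (1 - χ 5) * (u + ∑ b ∈ Finset.range g, y b * floorDefect g b) := by
    rw [mul_add, ← add_assoc, ← huu, halfSum, Finset.mul_sum, Nat.cast_sum,
      ← Finset.sum_add_distrib]
    refine Finset.sum_congr rfl fun b _ => ?_
    rw [← mul_assoc, hyy b]
    ring
  rw [key]
  exact one_add_mul_mem_oneModSubmonoid hw
    (add_mem hu (sum_mem fun b _ => mul_mem (hy b) (natCast_mem _ _)))

/-- For odd a, a^(2^(n+1)) ≡ 1 mod 2^(n+3), so every term is stable to that precision. -/
lemma DirichletCharacter.exists_halfSum_sub_eq (hm : 3 ≤ m) (hχ : χ.IsPrimitive) (k n q g : ℕ) :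
    ∃ z ∈ twoIntegers,
      χ.halfSum (k + 2 ^ (n + 1) * q) g - χ.halfSum k g = 2 ^ (n + 3) * z := by
  have h : ∀ b : ℕ, ∃ c : ℤ, ((2 * b + 1 : ℕ) : ℤ) ^ (2 ^ (n + 1) * q) - 1 = 2 ^ (n + 3) * c := by
    intro b
    obtain ⟨c, hc⟩ := exists_odd_pow_two_pow_eq (odd_two_mul_add_one b) n
    obtain ⟨e, he⟩ := sub_dvd_pow_sub_pow ((2 * b + 1 : ℤ) ^ 2 ^ (n + 1)) 1 q
    refine ⟨c * e, ?_⟩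
    have hc' := congrArg (Nat.cast : ℕ → ℤ) hc
    push_cast at hc' ⊢
    rw [one_pow] at he
    rw [pow_mul, he, hc']
    ring
  choose c hc using h
  refine ⟨∑ b ∈ Finset.range g, χ ((2 * b + 1 : ℕ) : ZMod (2 ^ m)) *
    (((2 * b + 1 : ℕ) : ℂ) ^ k * c b * floorDefect g b), sum_mem fun b _ => ?_, ?_⟩
  · exact mul_mem (χ.apply_mem_twoIntegers hm hχ _) (mul_mem (mul_mem (pow_mem (natCast_mem _ _) _)
      (intCast_mem _ _)) (natCast_mem _ _))
  · rw [halfSum, halfSum, ← Finset.sum_sub_distrib, Finset.mul_sum]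
    refine Finset.sum_congr rfl fun b _ => ?_
    have := congrArg (Int.cast : ℤ → ℂ) (hc b)
    rw [Int.cast_sub, Int.cast_pow, Int.cast_natCast, Int.cast_mul, Int.cast_pow, Int.cast_one,
      Int.cast_ofNat] at this
    rw [pow_add]
    linear_combination (χ ((2 * b + 1 : ℕ) : ZMod (2 ^ m)) * ((2 * b + 1 : ℕ) : ℂ) ^ k *
      floorDefect g b) * this

lemma DirichletCharacter.exists_LFunction_sub_halfSum_eq (hm : 3 ≤ m) (hχ : χ.IsPrimitive) {k : ℕ}
    (hk : χ (-1) * (-1) ^ k = -1) (K : ℕ) : ∃ R₀, ∀ R ≥ R₀, ∃ z ∈ twoIntegers,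
      (1 - 5 ^ (k + 1) * χ 5) * χ.LFunction (-(k : ℂ)) =
        -2 * χ 5 * 5 ^ k * χ.halfSum k (2 ^ R) + 2 ^ K * z := by
  obtain ⟨D, hD, h⟩ := χ.exists_mul_LFunction_sub_sum_eq hm hχ k
  obtain ⟨c, D', hD', rfl⟩ := Nat.exists_eq_two_pow_mul_odd hD
  have hwA := mem_twoIntegers_of_pow_eq_one χ.apply_five_pow_two_pow
  -- Dividing by D = 2^c D' loses c powers of 2, as D' is a unit; m keeps the level divisible by the
  -- modulus.
  refine ⟨K + c + m, fun R hR => ?_⟩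
  obtain ⟨ξ, hξ, h1⟩ := h (R + 2) (by omega)
  have h4 : 4 * 2 ^ R = 2 ^ (R + 2) := by rw [pow_add]; ring
  obtain ⟨ζ, hζ, h2⟩ := χ.exists_sum_eq_neg_two_mul_halfSum hm hχ hk (g := 2 ^ R)
    (h4 ▸ pow_dvd_pow 2 (by omega))
  rw [h4] at h2
  rw [h2] at h1
  obtain ⟨e, rfl⟩ : ∃ e, R = K + c + e := ⟨R - (K + c), by omega⟩
  have hD0 : (D' : ℂ) ≠ 0 := by exact_mod_cast hD'.pos.ne'
  refine ⟨2 ^ (e + 2) * ξ * ((D' : ℤ) : ℂ)⁻¹ + χ 5 * 5 ^ k * 4 * 2 ^ (c + e) * ζ, ?_, ?_⟩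
  · have h2A : (2 : ℂ) ∈ twoIntegers := ofNat_mem _ 2
    have h4A : (4 : ℂ) ∈ twoIntegers := ofNat_mem _ 4
    have h5A : (5 : ℂ) ∈ twoIntegers := ofNat_mem _ 5
    exact add_mem (mul_mem (mul_mem (pow_mem h2A _) hξ)
      (inv_intCast_mem_twoIntegers (by exact_mod_cast hD')))
      (mul_mem (mul_mem (mul_mem (mul_mem hwA (pow_mem h5A _)) h4A) (pow_mem h2A _)) hζ)
  · have h2c : (2 : ℂ) ^ c ≠ 0 := pow_ne_zero _ two_ne_zero
    have h5 : (2 : ℂ) ^ c * D' ≠ 0 := mul_ne_zero h2c hD0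
    apply mul_left_cancel₀ h5
    push_cast at h1 ⊢
    have h6 : (D' : ℂ) * (D' : ℂ)⁻¹ = 1 := mul_inv_cancel₀ hD0
    linear_combination h1 - 2 ^ c * 2 ^ K * 2 ^ (e + 2) * ξ * h6

end Character

/-! ### Size and differences of the normalized L-values -/

lemma add_two_mul_mem_oneModSubmonoid {w : ℂ} {s : ℕ} (hw : w ^ 2 ^ s = 1) (hw1 : w ≠ 1) {x y : ℂ}
    (hx : x ∈ oneModSubmonoid w) (hy : y ∈ twoIntegers) : x + 2 * y ∈ oneModSubmonoid w := by
  obtain ⟨hxA, u, hu, hxu⟩ := hx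
  obtain ⟨ρ, hρ, h⟩ := exists_one_sub_mul_eq_two hw hw1
  refine ⟨add_mem hxA (mul_mem (ofNat_mem _ 2) hy), u + ρ * y, add_mem hu (mul_mem hρ hy), ?_⟩
  rw [hxu, ← h]; ring

/-- Since 5^j - 1 is divisible by 4, hence by (1 - w)², replacing w by 5^j w alters 1 - w only by a
multiple of (1 - w)². -/
lemma exists_one_sub_mul_eq_one_sub_five_pow_mul {w : ℂ} {s : ℕ} (hw : w ^ 2 ^ s = 1) (hw1 : w ≠ 1)
    (j : ℕ) : ∃ u ∈ oneModSubmonoid w, (1 - w) * u = 1 - 5 ^ j * w := by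
  obtain ⟨ρ, hρ, h⟩ := exists_one_sub_mul_eq_two hw hw1
  obtain ⟨e, he⟩ := sub_dvd_pow_sub_pow (5 : ℤ) 1 j
  have he' := congrArg (Int.cast : ℤ → ℂ) he
  push_cast at he'
  rw [one_pow] at he'
  refine ⟨1 + (1 - w) * (-(ρ ^ 2 * w * e)), one_add_mul_mem_oneModSubmonoid hw
    (neg_mem (mul_mem (mul_mem (pow_mem hρ 2) (mem_twoIntegers_of_pow_eq_one hw))
      (intCast_mem _ _))), ?_⟩
  linear_combination w * he' - w * e * ((1 - w) * ρ + 2) * h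

lemma CongrModTwoPow.symm {r : ℕ} {x y : ℂ} (h : CongrModTwoPow r x y) : CongrModTwoPow r y x := by
  obtain ⟨z, hz, h⟩ := h
  exact ⟨-z, neg_mem (s := twoIntegers) hz, by linear_combination -h⟩

section Character

variable {m : ℕ} (χ : DirichletCharacter ℂ (2 ^ m))

lemma DirichletCharacter.apply_neg_one_mul_eq_neg_one {k : ℕ} (hk : χ (-1) ≠ (-1) ^ k) :
    χ (-1) * (-1) ^ k = -1 := by
  rcases χ.even_or_odd with h | h <;> rcases neg_one_pow_eq_or ℂ k with h' | h' <;>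
    rw [h, h'] at hk ⊢ <;> simp at hk ⊢

lemma DirichletCharacter.exists_mul_calL_eq (hm : 3 ≤ m) (hχ : χ.IsPrimitive) (k : ℕ) :
    ∃ u ∈ oneModSubmonoid (χ 5), (1 - χ 5) * u = 1 - 5 ^ (k + 1) * χ 5 ∧
      u * calL χ k = (1 - 5 ^ (k + 1) * χ 5) * χ.LFunction (-(k : ℂ)) := by
  obtain ⟨u, hu, h⟩ := exists_one_sub_mul_eq_one_sub_five_pow_mul χ.apply_five_pow_two_pow
    (χ.apply_five_ne_one hm hχ) (k + 1)
  refine ⟨u, hu, h, ?_⟩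
  rw [← h, calL]; ring

lemma not_five_dvd_two_pow (R : ℕ) : ¬ 5 ∣ 2 ^ R := fun h => by
  have := Nat.Prime.dvd_of_dvd_pow (by norm_num) h
  omega

lemma DirichletCharacter.exists_calL_eq_two_mul (hm : 3 ≤ m) (hχ : χ.IsPrimitive) {k : ℕ}
    (hk : χ (-1) * (-1) ^ k = -1) : ∃ x ∈ oneModSubmonoid (χ 5), calL χ k = 2 * x := by
  have hw := χ.apply_five_pow_two_pow
  have hw1 := χ.apply_five_ne_one hm hχ
  obtain ⟨u, hu, -, h⟩ := χ.exists_mul_calL_eq hm hχ k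
  obtain ⟨R, hR⟩ := χ.exists_LFunction_sub_halfSum_eq hm hχ hk 2
  obtain ⟨z, hz, hR⟩ := hR R le_rfl
  obtain ⟨hu0, huinv⟩ := inv_mem_oneModSubmonoid hw hu
  have hT := χ.halfSum_mem_oneModSubmonoid hm hχ k (not_five_dvd_two_pow R)
  have h5 : (5 : ℂ) ∈ oneModSubmonoid (χ 5) := by
    have := odd_mem_oneModSubmonoid hw hw1 (c := 5) (by decide)
    exact_mod_cast this
  refine ⟨-(χ 5 * 5 ^ k * χ.halfSum k (2 ^ R) * u⁻¹) + 2 * (z * u⁻¹),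
    add_two_mul_mem_oneModSubmonoid hw hw1 (neg_mem_oneModSubmonoid hw hw1
      (mul_mem (mul_mem (mul_mem (self_mem_oneModSubmonoid hw) (pow_mem h5 k)) hT) huinv))
      (mul_mem hz huinv.1), ?_⟩
  rw [hR] at h
  apply mul_left_cancel₀ hu0
  rw [h]
  field_simp

lemma DirichletCharacter.exists_calL_sub_calL_eq (hm : 3 ≤ m) (hχ : χ.IsPrimitive) {k : ℕ}
    (hk : χ (-1) * (-1) ^ k = -1) (n : ℕ) {q : ℕ} (hq : _root_.Odd q) : ∃ z ∈ twoIntegers,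
      calL χ (k + 2 ^ (n + 1) * q) - calL χ k = 2 ^ (n + 4) * ((1 - χ 5)⁻¹ + z) := by
  have hw := χ.apply_five_pow_two_pow
  have hw1 := χ.apply_five_ne_one hm hχ
  have hwA := mem_twoIntegers_of_pow_eq_one hw
  have hk' : χ (-1) * (-1) ^ (k + 2 ^ (n + 1) * q) = -1 := by
    have he : _root_.Even (2 ^ (n + 1) * q) := ⟨2 ^ n * q, by ring⟩
    rw [pow_add, he.neg_one_pow, mul_one, hk]
  obtain ⟨u, hu, hπu, h⟩ := χ.exists_mul_calL_eq hm hχ k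
  obtain ⟨u', hu', hπu', h'⟩ := χ.exists_mul_calL_eq hm hχ (k + 2 ^ (n + 1) * q)
  obtain ⟨R₁, hR₁⟩ := χ.exists_LFunction_sub_halfSum_eq hm hχ hk (n + 4)
  obtain ⟨R₂, hR₂⟩ := χ.exists_LFunction_sub_halfSum_eq hm hχ hk' (n + 4)
  set R := max R₁ R₂ with hR
  obtain ⟨z, hz, hL⟩ := hR₁ R (le_max_left _ _)
  obtain ⟨z', hz', hL'⟩ := hR₂ R (le_max_right _ _)
  rw [hL] at h
  rw [hL'] at h'
  obtain ⟨hu0, hv⟩ := inv_mem_oneModSubmonoid hw hu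
  obtain ⟨hu0', hv'⟩ := inv_mem_oneModSubmonoid hw hu'
  have hT := χ.halfSum_mem_oneModSubmonoid hm hχ k (not_five_dvd_two_pow R)
  obtain ⟨t, ht, hTT⟩ := χ.exists_halfSum_sub_eq hm hχ k n q (2 ^ R)
  obtain ⟨c, hc⟩ := exists_five_pow_two_pow_mul_eq (n + 1) hq
  have h5 : (5 : ℂ) ∈ oneModSubmonoid (χ 5) := by
    have := odd_mem_oneModSubmonoid hw hw1 (c := 5) (by decide)
    exact_mod_cast this
  have hcC : (5 : ℂ) ^ (2 ^ (n + 1) * q) = 1 + 2 ^ (n + 3) * ((2 * c + 1 : ℕ) : ℂ) := by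
    exact_mod_cast congrArg (Nat.cast : ℕ → ℂ) hc
  -- All factors are congruent to 1 modulo 1 - χ(5), and so is -1: this product is the whole
  -- coefficient of 2^(n+4)/(1 - χ(5)).
  obtain ⟨-, y, hy, hX⟩ := neg_mem_oneModSubmonoid hw hw1 (mul_mem (mul_mem (mul_mem (mul_mem (mul_mem
    (self_mem_oneModSubmonoid hw) hT) hv) hv') (pow_mem h5 k))
    (odd_mem_oneModSubmonoid hw hw1 (odd_two_mul_add_one c)))
  have hπ : 1 - χ 5 ≠ 0 := sub_ne_zero.2 hw1.symm
  set w := χ 5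
  set k' := k + 2 ^ (n + 1) * q with hkk
  set T := χ.halfSum k (2 ^ R)
  set T' := χ.halfSum k' (2 ^ R)
  set o : ℂ := ((2 * c + 1 : ℕ) : ℂ)
  have h5k : (5 : ℂ) ^ k' = 5 ^ k * (1 + 2 ^ (n + 3) * o) := by rw [hkk, pow_add, hcC]
  refine ⟨y + (-(w * 5 ^ k' * t * u'⁻¹) + (z' * u'⁻¹ - z * u⁻¹)), ?_, ?_⟩
  · exact add_mem hy (add_mem (neg_mem (mul_mem (mul_mem (mul_mem hwA (pow_mem h5.1 _)) ht) hv'.1))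
      (sub_mem (mul_mem hz' hv'.1) (mul_mem hz hv.1)))
  · have e1 : calL χ k = (-2 * w * 5 ^ k * T + 2 ^ (n + 4) * z) * u⁻¹ := by
      rw [← h]; field_simp
    have e2 : calL χ k' = (-2 * w * 5 ^ k' * T' + 2 ^ (n + 4) * z') * u'⁻¹ := by
      rw [← h']; field_simp
    -- In 5^k' u - 5^k u', multiplied by 1 - w, the terms containing w cancel and leave 5^k' - 5^k.
    -- This is the source of the pole 1/(1 - w).
    have e3 : (5 : ℂ) ^ k' * u'⁻¹ - 5 ^ k * u⁻¹ =
        (1 - w)⁻¹ * (u⁻¹ * u'⁻¹ * 5 ^ k * 2 ^ (n + 3) * o) := by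
      have : (1 - w) * (5 ^ k' * u - 5 ^ k * u') = 5 ^ k * 2 ^ (n + 3) * o := by
        linear_combination (5 : ℂ) ^ k' * hπu - 5 ^ k * hπu' + h5k
      field_simp
      linear_combination this
    have e4 : (1 - w)⁻¹ * (-(w * T * u⁻¹ * u'⁻¹ * 5 ^ k * o)) = (1 - w)⁻¹ + y := by
      rw [hX]; field_simp
    rw [e1, e2]
    linear_combination (-2 * w * T) * e3 + 2 ^ (n + 4) * e4 - 2 * w * 5 ^ k' * u'⁻¹ * hTT

lemma DirichletCharacter.calL_eq_zero (hm : 3 ≤ m) {l : ℕ} (hl : χ (-1) = (-1) ^ l) :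
    calL χ l = 0 := by
  have hχ0 : χ 0 = 0 := by simpa using χ.apply_even_eq_zero (by omega) (a := 0) (by simp)
  rw [calL]
  refine mul_eq_zero_of_right _ ?_
  rcases Nat.even_or_odd' l with ⟨r, rfl | rfl⟩
  · have he : χ.Even := by rw [DirichletCharacter.Even, hl, pow_mul]; simp
    rcases Nat.eq_zero_or_pos r with rfl | hr
    · rw [mul_zero, Nat.cast_zero, neg_zero, DirichletCharacter.LFunction,
        ZMod.LFunction_apply_zero_of_even he.to_fun, hχ0]
      simp
    · have : NeZero r := ⟨hr.ne'⟩
      have := he.LFunction_neg_two_mul_nat r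
      exact_mod_cast this
  · have ho : χ.Odd := by rw [DirichletCharacter.Odd, hl, pow_succ, pow_mul]; simp
    have := ho.LFunction_neg_two_mul_nat_sub_one r
    rw [← this]
    congr 1
    push_cast; ring

/-- With 2^(t+1) the exact power of 2 in l - k, the difference is 2^(t+4)((1 - χ(5))⁻¹ + z):
divisible by 2^(t+3) because 2/(1 - χ(5)) is 2-integral, but not by 2^(t+4). -/
lemma DirichletCharacter.congrModTwoPow_calL_iff_of_lt (hm : 3 ≤ m) (hχ : χ.IsPrimitive) {k l : ℕ}
    (hk : χ (-1) * (-1) ^ k = -1) (hkl : k < l) (hpar : k ≡ l [MOD 2]) (n : ℕ) :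
    CongrModTwoPow (n + 2) (calL χ l) (calL χ k) ↔ k ≡ l [MOD 2 ^ n] := by
  have hw := χ.apply_five_pow_two_pow
  have hw1 := χ.apply_five_ne_one hm hχ
  have hπ : 1 - χ 5 ≠ 0 := sub_ne_zero.2 hw1.symm
  have h2A : (2 : ℂ) ∈ twoIntegers := ofNat_mem _ 2
  obtain ⟨t, q, hq, hdiff⟩ := Nat.exists_eq_two_pow_mul_odd (n := l - k) (by omega)
  have ht : t ≠ 0 := by
    rintro rfl
    rw [pow_zero, one_mul] at hdiff
    have := (Nat.modEq_iff_dvd' hkl.le).1 hpar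
    rw [hdiff] at this
    obtain ⟨v, rfl⟩ := hq
    omega
  obtain ⟨t, rfl⟩ := Nat.exists_eq_succ_of_ne_zero ht
  obtain rfl : l = k + 2 ^ (t + 1) * q := by rw [Nat.succ_eq_add_one] at hdiff; omega
  obtain ⟨z, hz, h⟩ := χ.exists_calL_sub_calL_eq hm hχ hk t hq
  obtain ⟨ρ, hρ, hρ2⟩ := exists_one_sub_mul_eq_two hw hw1
  have hmod : k ≡ k + 2 ^ (t + 1) * q [MOD 2 ^ n] ↔ n ≤ t + 1 := by
    rw [Nat.modEq_iff_dvd' hkl.le, Nat.add_sub_cancel_left,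
      ((Nat.coprime_two_left.2 hq).pow_left n).dvd_mul_right, Nat.pow_dvd_pow_iff_le_right (by omega)]
  rw [hmod, CongrModTwoPow]
  constructor
  · rintro ⟨x, hx, hxx⟩
    by_contra! hlt
    obtain ⟨e, rfl⟩ : ∃ e, n = t + 2 + e := ⟨n - (t + 2), by omega⟩
    apply inv_one_sub_notMem_twoIntegers hw hw1
    have : (1 - χ 5)⁻¹ = 2 ^ e * x - z := by
      have h2 : (2 : ℂ) ^ (t + 4) ≠ 0 := pow_ne_zero _ two_ne_zero
      apply mul_left_cancel₀ h2
      rw [h] at hxx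
      linear_combination hxx
    rw [this]
    exact sub_mem (mul_mem (pow_mem h2A _) hx) hz
  · intro hle
    obtain ⟨e, he⟩ : ∃ e, t + 1 = n + e := ⟨t + 1 - n, by omega⟩
    refine ⟨2 ^ e * (ρ + 2 * z), mul_mem (s := twoIntegers) (pow_mem h2A _)
      (add_mem hρ (mul_mem h2A hz)), ?_⟩
    have h3 : 2 * (1 - χ 5)⁻¹ = ρ := by rw [← hρ2]; field_simp
    rw [h, show t + 4 = n + e + 3 by omega]
    linear_combination 2 ^ (n + e + 2) * h3

end Character

theorem theorem1p1 (m : ℕ) (hm : 3 ≤ m) (χ : DirichletCharacter ℂ (2 ^ m))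
    (hχ : χ.IsPrimitive) (k : ℕ) (hk : χ (-1) ≠ (-1) ^ k) (n : ℕ) (hn : 1 ≤ n) :
    IsTwoIntegral (calL χ k) ∧
    (∀ q d : ℕ, Odd q → (d = 0 ∨ d = 1) → d ≡ k [MOD 2] →
      CongrModTwoPow (n + 3) (calL χ (k + 2 ^ n * q) - calL χ k)
        (2 ^ (n + 2) / (1 - (starRingEnd ℂ) (χ 5)) * calL χ d)) ∧
    (∀ l : ℕ, CongrModTwoPow (n + 2) (calL χ k) (calL χ l) ↔ k ≡ l [MOD 2 ^ n]) := by
  have hw := χ.apply_five_pow_two_pow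
  have hw1 := χ.apply_five_ne_one hm hχ
  have hπ : 1 - χ 5 ≠ 0 := sub_ne_zero.2 hw1.symm
  have h2A : (2 : ℂ) ∈ twoIntegers := ofNat_mem _ 2
  have hk' := χ.apply_neg_one_mul_eq_neg_one hk
  have hpow : ∀ l : ℕ, l ≡ k [MOD 2] → χ (-1) * (-1) ^ l = -1 := by
    intro l hl
    have hl' : l % 2 = k % 2 := hl
    rw [neg_one_pow_eq_pow_mod_two] at hk' ⊢
    rw [hl', hk']
  obtain ⟨x, hx, hkx⟩ := χ.exists_calL_eq_two_mul hm hχ hk'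
  refine ⟨?_, ?_, ?_⟩
  · rw [hkx]
    exact mul_mem (s := twoIntegers) h2A hx.1
  · intro q d hq _ hd
    obtain ⟨n, rfl⟩ : ∃ r, n = r + 1 := ⟨n - 1, by omega⟩
    obtain ⟨z, hz, h⟩ := χ.exists_calL_sub_calL_eq hm hχ hk' n hq
    obtain ⟨x, hx, hdx⟩ := χ.exists_calL_eq_two_mul hm hχ (hpow d hd)
    have hw0 : χ 5 ≠ 0 := by
      intro h0
      rw [h0, zero_pow (by positivity)] at hw
      exact zero_ne_one hw
    have hconj : (starRingEnd ℂ) (χ 5) = (χ 5)⁻¹ :=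
      (Complex.inv_eq_conj (Complex.norm_eq_one_of_pow_eq_one hw (by positivity))).symm
    obtain ⟨-, y, hy, hX⟩ := neg_mem_oneModSubmonoid hw hw1
      (mul_mem (self_mem_oneModSubmonoid hw) hx)
    -- Both sides are 2^(n+4) times (1 - χ(5))⁻¹ plus a 2-integral number, with respective
    -- remainders z and y.
    refine ⟨z - y, (sub_mem hz hy : z - y ∈ twoIntegers), ?_⟩
    have hinv : (1 - (χ 5)⁻¹)⁻¹ = -χ 5 * (1 - χ 5)⁻¹ := by
      have h1 : 1 - (χ 5)⁻¹ = -((1 - χ 5) * (χ 5)⁻¹) := by field_simp; ring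
      rw [h1, inv_neg, mul_inv, inv_inv]; ring
    have hX' : (1 - χ 5)⁻¹ * -(χ 5 * x) = (1 - χ 5)⁻¹ + y := by
      rw [hX]; field_simp
    rw [h, hdx, hconj, div_eq_mul_inv, hinv]
    linear_combination (-2 ^ (n + 4)) * hX'
  · intro l
    by_cases hpar : k ≡ l [MOD 2]
    · rcases lt_trichotomy k l with hlt | rfl | hlt
      · rw [← χ.congrModTwoPow_calL_iff_of_lt hm hχ hk' hlt hpar]
        exact ⟨CongrModTwoPow.symm, CongrModTwoPow.symm⟩
      · exact ⟨fun _ => rfl, fun _ => ⟨0, zero_mem twoIntegers, by ring⟩⟩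
      · rw [χ.congrModTwoPow_calL_iff_of_lt hm hχ (hpow l hpar.symm) hlt hpar.symm]
        exact ⟨Nat.ModEq.symm, Nat.ModEq.symm⟩
    · have hl : χ (-1) = (-1) ^ l := by
        by_contra hne
        apply hpar
        have h1 := χ.apply_neg_one_mul_eq_neg_one hne
        have h2 : (-1 : ℂ) ^ k = (-1) ^ l := by
          have h0 : χ (-1) ≠ 0 := by
            intro h0
            rw [h0, zero_mul] at h1
            norm_num at h1
          exact mul_left_cancel₀ h0 (hk'.trans h1.symm)
        rw [neg_one_pow_eq_pow_mod_two, neg_one_pow_eq_pow_mod_two (n := l)] at h2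
        rcases Nat.mod_two_eq_zero_or_one k with a | a <;>
          rcases Nat.mod_two_eq_zero_or_one l with b | b <;> rw [a, b] at h2
        · exact a.trans b.symm
        · norm_num at h2
        · norm_num at h2
        · exact a.trans b.symm
      constructor
      · rintro ⟨z, hz, h⟩
        exfalso
        obtain ⟨-, y, hy, hxy⟩ := hx
        obtain ⟨ρ, hρ, hρ2⟩ := exists_one_sub_mul_eq_two hw hw1
        apply inv_one_sub_notMem_twoIntegers hw hw1
        rw [hkx, χ.calL_eq_zero hm hl, sub_zero] at h
        -- An element congruent to 1 modulo 1 - χ(5) cannot be divisible by 2, since 1 - χ(5) would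
        -- then divide 1.
        have h2 : x = 2 * (2 ^ n * z) := by
          apply mul_left_cancel₀ (two_ne_zero (α := ℂ))
          rw [h]; ring
        have h3 : (1 - χ 5)⁻¹ = ρ * (2 ^ n * z) - y := by
          field_simp
          linear_combination h2 - hxy - (2 ^ n * z) * hρ2
        rw [h3]
        exact sub_mem (mul_mem hρ (mul_mem (pow_mem h2A _) hz)) hy
      · intro h
        exact absurd (h.of_dvd (dvd_pow_self 2 (by omega))) hpar
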